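/- For integers $n,k\ge 1$ and $0<\rho<1$ let \[ \mathcal M_{k,\rho}=\Big\{M\in[0,\rho]^{n\times n}:\ M_{ii}=0 \text{ for all } i,\ \ M_{ij}=M_{ji}=Q_{z_iz_j}\text{ for all } i\ne j,\ \text{ for some } z\in[k]^n,\ Q=Q^\top\in[0,\rho]^{k\times k}\Big\}. \] Given $M\in\mathcal M_{k,\rho}$, let $A\in\{0,1\}^{n\times n}$ be the adjacency matrix of the random graph with $A_{ii}=0$, $A_{ij}=A_{ji}\sim\mathrm{Bern}(M_{ij})$ for $i<j$, where $(A_{ij})_{i<j}$ are mutually independent. For $\tau>0$ let $T_\tau(A)$ be the matrix obtained from $A$ by replacing the $i$th row and the $i$th column with zeros for every node $i$ whose degree $\sum_jA_{ij}$ exceeds $\tau$, and let $\widehat M$ be a rank-$k$ truncated SVD of $T_\tau(A)$, i.e. any estimator (function of $A$) with \[ \widehat M\in\operatorname*{arg\,min}_{\mathrm{rank}(X)\le k}\|T_\tau(A)-X\|_{\rm F}^2 . \] Let $\ell(\widehat M,M)=\binom n2^{-1}\sum_{1\le i<j\le n}(\widehat M_{ij}-M_{ij})^2$. **Proposition.**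 For all sufficiently large constants $C_1,C_2>0$ (that is, all $C_1\ge c_1$ and $C_2\ge c_2$ for some absolute constants $c_1,c_2>0$) there is a constant $C_3>0$, depending only on $C_1$ and $C_2$, such that for all $n$, $k$ and $0<\rho<1$ with $n\rho\ge C_1$, with $\tau=C_2n\rho$, and for every $M\in\mathcal M_{k,\rho}$, \[ \mathbb E\big[\ell(\widehat M,M)\big]\le C_3\,\frac{\rho k}{n}. \] -/

import Mathlib

open MeasureTheory ProbabilityTheory

/-- The class of sparse stochastic block model connectivity matrices: `M` is an `n × n` matrix with
entries in `[0, ρ]`, zero diagonal, and `M i j = Q (z i) (z j)` off the diagonal, for some labelling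
`z` of the nodes by `k` labels and some symmetric `k × k` matrix `Q` with entries in `[0, ρ]`. -/
def sparseSBM (n k : ℕ) (ρ : ℝ) : Set (Matrix (Fin n) (Fin n) ℝ) :=
  {M | (∀ i j, M i j ∈ Set.Icc 0 ρ) ∧ (∀ i, M i i = 0) ∧
    ∃ (z : Fin n → Fin k) (Q : Matrix (Fin k) (Fin k) ℝ),
      Q.IsSymm ∧ (∀ a b, Q a b ∈ Set.Icc 0 ρ) ∧
      ∀ i j, i ≠ j → M i j = Q (z i) (z j) ∧ M j i = Q (z i) (z j)}

/-- `A` is the adjacency matrix of a random simple graph on `n` nodes in which the edges are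
independent and the edge `{i, j}` is present with probability `M i j`. -/
structure IsRandomAdjacency {Ω : Type*} [MeasurableSpace Ω] (μ : Measure Ω) {n : ℕ}
    (M : Matrix (Fin n) (Fin n) ℝ) (A : Ω → Matrix (Fin n) (Fin n) ℝ) : Prop where
  measurable_entry : ∀ i j, Measurable fun ω => A ω i j
  zero_or_one : ∀ ω i j, A ω i j = 0 ∨ A ω i j = 1
  symm : ∀ ω i j, A ω i j = A ω j i
  diag : ∀ ω i, A ω i i = 0
  prob_edge : ∀ i j, i < j → μ {ω | A ω i j = 1} = ENNReal.ofReal (M i j)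
  indep : iIndepFun (fun (e : {p : Fin n × Fin n // p.1 < p.2}) ω => A ω e.1.1 e.1.2) μ

/-- The degree of node `i` in the graph with adjacency matrix `A`. -/
def nodeDegree {n : ℕ} (A : Matrix (Fin n) (Fin n) ℝ) (i : Fin n) : ℝ := ∑ j, A i j

open Classical in
/-- The degree truncation `T_τ(A)`: the `i`-th row and the `i`-th column of `A` are replaced by
zeros for every node `i` whose degree in `A` exceeds `τ`. -/
noncomputable def degreeTruncation {n : ℕ} (τ : ℝ) (A : Matrix (Fin n) (Fin n) ℝ) :
    Matrix (Fin n) (Fin n) ℝ :=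
  fun i j => if τ < nodeDegree A i ∨ τ < nodeDegree A j then 0 else A i j

/-- The squared Frobenius norm. -/
def frobeniusSq {n : ℕ} (B : Matrix (Fin n) (Fin n) ℝ) : ℝ := ∑ i, ∑ j, B i j ^ 2

/-- `X` minimizes `‖B - X‖_F²` among the matrices of rank at most `k`, that is, `X` is a rank-`k`
truncated singular value decomposition of `B`. -/
def IsBestRankApprox {n : ℕ} (k : ℕ) (B X : Matrix (Fin n) (Fin n) ℝ) : Prop :=
  X.rank ≤ k ∧ ∀ Y : Matrix (Fin n) (Fin n) ℝ, Y.rank ≤ k → frobeniusSq (B - X) ≤ frobeniusSq (B - Y)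

/-- The loss: the mean over all pairs `i < j` of the squared error of the entry `(i, j)`. -/
noncomputable def graphonLoss {n : ℕ} (X M : Matrix (Fin n) (Fin n) ℝ) : ℝ :=
  ((n.choose 2 : ℕ) : ℝ)⁻¹ *
    ∑ p ∈ Finset.univ.filter (fun p : Fin n × Fin n => p.1 < p.2), (X p.1 p.2 - M p.1 p.2) ^ 2

/-! Filling in the diagonal of `M` gives a block matrix `Y` of rank at most `k`. A best rank-`k`
approximation `X` of `T` satisfies `‖X - Y‖_F² ≤ 2⟨X - Y, T - Y⟩`, and a matrix of rank at most `2k`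
pairs with `T - Y` to at most `√(2k) ‖T - Y‖ ‖X - Y‖_F`. Hence `‖X - Y‖_F² ≤ 8k ‖T - Y‖²`, where
`‖·‖` is the spectral norm. As `Y - M` is a diagonal with entries at most `ρ`, it remains to show
that the expectation of `‖T - M‖²` is `O(nρ)`.

This follows Friedman–Kahn–Szemerédi and Feige–Ofek. The unit ball is replaced by a net of scaled
integer vectors `f`, `g`, and the bilinear form is split at `|f_i g_j| = δ²`, where `δ⁴ = nρ`. Light
pairs are handled by exponential moments and a union bound over the net. Heavy pairs with very
unbalanced entries are paid for by the degree cap. The other heavy pairs are grouped by powers of 4,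
and the edges between two level sets are bounded by a discrepancy estimate over all pairs of vertex
sets. Trimming moves from the matrix to the test vectors: zeroing coordinates keeps `f` in the net,
so the random set of removed nodes needs no union bound. The signal lost on the removed nodes is
bounded in Frobenius norm through their number.

Each random estimate is an exponential moment `Z` with a bounded mean, summed over all test objects.
Since `exp a ≤ Z` implies `a ≤ √Z`, the square of the resulting spectral bound is controlled by
terms linear in such `Z`, so taking expectations needs only first moments and no exceptional event.

The carrying lemmas are `IsBestRankApprox.frobeniusSq_sub_le`, `hasOpBound_of_latticeBall`,
`sum_heavy_le`, `hasOpBound_noiseBound` and `IsRandomAdjacency.integral_sq_noiseBound_le`. -/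

open scoped Matrix

/-! ### Exponential moments of edge statistics -/

namespace IsRandomAdjacency

variable {Ω : Type*} [MeasurableSpace Ω] {μ : Measure Ω} {n : ℕ}
  {M : Matrix (Fin n) (Fin n) ℝ} {A : Ω → Matrix (Fin n) (Fin n) ℝ}

/-- Every function of a random adjacency matrix is integrable, as it takes finitely many values. -/
theorem integrable_comp [IsProbabilityMeasure μ] (h : IsRandomAdjacency μ M A)
    (g : Matrix (Fin n) (Fin n) ℝ → ℝ) : Integrable (fun ω => g (A ω)) μ := by
  classical
  let enc : Ω → (Fin n → Fin n → Bool) := fun ω i j => decide (A ω i j = 1)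
  have henc : Measurable enc := by
    refine measurable_pi_lambda _ fun i => measurable_pi_lambda _ fun j => ?_
    refine measurable_to_bool ?_
    have : (fun ω => enc ω i j) ⁻¹' {true} = (fun ω => A ω i j) ⁻¹' {1} := by
      ext ω; simp [enc]
    rw [this]
    exact h.measurable_entry i j (measurableSet_singleton _)
  let dec : (Fin n → Fin n → Bool) → Matrix (Fin n) (Fin n) ℝ :=
    fun b i j => if b i j then 1 else 0
  have hdec : ∀ ω, dec (enc ω) = A ω := by
    intro ω; ext i j
    rcases h.zero_or_one ω i j with h0 | h0 <;> simp [dec, enc, h0]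
  have hfin : IsFiniteMeasure (μ.map enc) := Measure.isFiniteMeasure_map μ enc
  have : Integrable (fun b => g (dec b)) (μ.map enc) := Integrable.of_finite
  simpa [Function.comp_def, hdec] using this.comp_measurable henc

theorem integral_entry (h : IsRandomAdjacency μ M A) (hM : ∀ i j, 0 ≤ M i j)
    {i j : Fin n} (hij : i < j) : ∫ ω, A ω i j ∂μ = M i j := by
  have hs : MeasurableSet {ω | A ω i j = 1} := h.measurable_entry i j (measurableSet_singleton 1)
  have : (fun ω => A ω i j) = Set.indicator {ω | A ω i j = 1} 1 := by
    ext ω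
    rcases h.zero_or_one ω i j with h0 | h0 <;> simp [Set.indicator, h0]
  rw [this, integral_indicator_one hs, measureReal_def, h.prob_edge i j hij,
    ENNReal.toReal_ofReal (hM i j)]

/-- Independence factors the expectation, and each factor is `1 + p (exp w - 1) ≤ exp (p (exp w -
1))`. -/
theorem integral_exp_edges_le [IsProbabilityMeasure μ] (h : IsRandomAdjacency μ M A)
    (hM : ∀ i j, 0 ≤ M i j) (w : {p : Fin n × Fin n // p.1 < p.2} → ℝ) :
    ∫ ω, Real.exp (∑ e, w e * A ω e.1.1 e.1.2) ∂μ ≤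
      Real.exp (∑ e, M e.1.1 e.1.2 * (Real.exp (w e) - 1)) := by
  have hind : iIndepFun (fun (e : {p : Fin n × Fin n // p.1 < p.2}) ω => w e * A ω e.1.1 e.1.2) μ :=
    h.indep.comp (fun e x => w e * x) (fun e => measurable_const_mul _)
  have key := hind.mgf_sum (t := 1) (fun e => (h.measurable_entry e.1.1 e.1.2).const_mul (w e))
    Finset.univ
  simp only [mgf, one_mul, Finset.sum_apply] at key
  rw [key, Real.exp_sum]
  refine Finset.prod_le_prod (fun e _ => integral_nonneg fun ω => (Real.exp_pos _).le) fun e _ => ?_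
  have h1 : (fun ω => Real.exp (w e * A ω e.1.1 e.1.2)) =
      fun ω => 1 + (Real.exp (w e) - 1) * A ω e.1.1 e.1.2 := by
    ext ω
    rcases h.zero_or_one ω e.1.1 e.1.2 with h0 | h0 <;> simp [h0]
  rw [h1, integral_add (integrable_const _)
    ((h.integrable_comp fun B => B e.1.1 e.1.2).const_mul _), integral_const_mul,
    h.integral_entry hM e.2]
  simp only [integral_const, probReal_univ, smul_eq_mul, mul_one]
  have := Real.add_one_le_exp (M e.1.1 e.1.2 * (Real.exp (w e) - 1))
  linarith

end IsRandomAdjacency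

theorem sum_sum_eq_sum_lt {n : ℕ} (F : Fin n → Fin n → ℝ) (hF : ∀ i, F i i = 0) :
    ∑ i, ∑ j, F i j =
      ∑ e : {p : Fin n × Fin n // p.1 < p.2}, (F e.1.1 e.1.2 + F e.1.2 e.1.1) := by
  classical
  rw [← Finset.sum_subtype (Finset.univ.filter fun p : Fin n × Fin n => p.1 < p.2)
    (by simp) (fun p => F p.1 p.2 + F p.2 p.1), Finset.sum_add_distrib]
  have hswap : ∑ p ∈ Finset.univ.filter (fun p : Fin n × Fin n => p.1 < p.2), F p.2 p.1 =
      ∑ p ∈ Finset.univ.filter (fun p : Fin n × Fin n => p.2 < p.1), F p.1 p.2 := by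
    refine Finset.sum_nbij' Prod.swap Prod.swap ?_ ?_ ?_ ?_ ?_ <;> simp
  rw [hswap, Finset.sum_filter, Finset.sum_filter, ← Finset.sum_add_distrib,
    ← Fintype.sum_prod_type' F]
  refine Finset.sum_congr rfl fun p _ => ?_
  rcases lt_trichotomy p.1 p.2 with hp | hp | hp
  · simp [hp, hp.not_gt]
  · simp [hp, hF]
  · simp [hp, hp.not_gt]

/-- The exponential moments of a linear statistic of the adjacency matrix. -/
theorem IsRandomAdjacency.integral_exp_le {Ω : Type*} [MeasurableSpace Ω] {μ : Measure Ω}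
    [IsProbabilityMeasure μ] {n : ℕ} {M : Matrix (Fin n) (Fin n) ℝ}
    {A : Ω → Matrix (Fin n) (Fin n) ℝ} (h : IsRandomAdjacency μ M A)
    (hM : ∀ i j, 0 ≤ M i j) (hsymm : ∀ i j, M i j = M j i) (hdiag : ∀ i, M i i = 0)
    (c : Fin n → Fin n → ℝ) :
    ∫ ω, Real.exp (∑ i, ∑ j, A ω i j * c i j) ∂μ ≤
      Real.exp (2⁻¹ * ∑ i, ∑ j, M i j * (Real.exp (2 * c i j) - 1)) := by
  have h1 : ∀ ω, ∑ i, ∑ j, A ω i j * c i j =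
      ∑ e : {p : Fin n × Fin n // p.1 < p.2}, (c e.1.1 e.1.2 + c e.1.2 e.1.1) * A ω e.1.1 e.1.2 := by
    intro ω
    rw [sum_sum_eq_sum_lt _ fun i => by rw [h.diag, zero_mul]]
    refine Finset.sum_congr rfl fun e _ => ?_
    rw [h.symm ω e.1.2 e.1.1]; ring
  simp only [h1]
  refine (h.integral_exp_edges_le hM _).trans (Real.exp_le_exp.2 ?_)
  rw [sum_sum_eq_sum_lt _ fun i => by rw [hdiag, zero_mul], Finset.mul_sum]
  refine Finset.sum_le_sum fun e _ => ?_
  rw [hsymm e.1.2 e.1.1, ← mul_add, ← mul_assoc, mul_comm 2⁻¹, mul_assoc]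
  refine mul_le_mul_of_nonneg_left ?_ (hM _ _)
  -- With `a`, `b` the coefficients of the two orientations, `exp (a + b) ≤ (exp (2a) + exp (2b)) /
  -- 2`; so `c` need not be symmetric.
  rw [Real.exp_add, two_mul, two_mul, Real.exp_add, Real.exp_add]
  nlinarith [sq_nonneg (Real.exp (c e.1.1 e.1.2) - Real.exp (c e.1.2 e.1.1))]

/-! ### Spectral norm and low-rank approximation -/

/-- `κ` bounds the spectral norm of `B`. -/
def HasOpBound {n : ℕ} (B : Matrix (Fin n) (Fin n) ℝ) (κ : ℝ) : Prop :=
  ∀ x y : Fin n → ℝ, x ⬝ᵥ x ≤ 1 → y ⬝ᵥ y ≤ 1 → x ⬝ᵥ B *ᵥ y ≤ κ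

theorem HasOpBound.add {n : ℕ} {B C : Matrix (Fin n) (Fin n) ℝ} {κ η : ℝ} (hB : HasOpBound B κ)
    (hC : HasOpBound C η) : HasOpBound (B + C) (κ + η) := by
  intro x y hx hy
  rw [Matrix.add_mulVec, dotProduct_add]
  exact add_le_add (hB x y hx hy) (hC x y hx hy)

theorem frobeniusSq_nonneg {n : ℕ} (B : Matrix (Fin n) (Fin n) ℝ) : 0 ≤ frobeniusSq B :=
  Finset.sum_nonneg fun _ _ => Finset.sum_nonneg fun _ _ => sq_nonneg _

theorem sq_dotProduct_mulVec_le {n : ℕ} (B : Matrix (Fin n) (Fin n) ℝ) (x y : Fin n → ℝ) :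
    (x ⬝ᵥ B *ᵥ y) ^ 2 ≤ frobeniusSq B * ((x ⬝ᵥ x) * (y ⬝ᵥ y)) := by
  have h1 : x ⬝ᵥ B *ᵥ y = ∑ p : Fin n × Fin n, B p.1 p.2 * (x p.1 * y p.2) := by
    rw [Fintype.sum_prod_type]
    simp only [dotProduct, Matrix.mulVec, Finset.mul_sum]
    exact Finset.sum_congr rfl fun i _ => Finset.sum_congr rfl fun j _ => by ring
  have h2 : frobeniusSq B = ∑ p : Fin n × Fin n, B p.1 p.2 ^ 2 := by
    rw [Fintype.sum_prod_type]; rfl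
  have h3 : (x ⬝ᵥ x) * (y ⬝ᵥ y) = ∑ p : Fin n × Fin n, (x p.1 * y p.2) ^ 2 := by
    rw [Fintype.sum_prod_type]
    simp only [dotProduct, Finset.sum_mul_sum]
    exact Finset.sum_congr rfl fun i _ => Finset.sum_congr rfl fun j _ => by ring
  rw [h1, h2, h3]
  exact Finset.sum_mul_sq_le_sq_mul_sq _ _ _

theorem hasOpBound_of_frobeniusSq_le {n : ℕ} {B : Matrix (Fin n) (Fin n) ℝ} {κ : ℝ} (hκ : 0 ≤ κ)
    (h : frobeniusSq B ≤ κ ^ 2) : HasOpBound B κ := by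
  intro x y hx hy
  refine le_of_sq_le_sq ?_ hκ
  refine (sq_dotProduct_mulVec_le B x y).trans (le_trans ?_ h)
  have hx0 : 0 ≤ x ⬝ᵥ x := Finset.sum_nonneg fun i _ => mul_self_nonneg _
  have hy0 : 0 ≤ y ⬝ᵥ y := Finset.sum_nonneg fun i _ => mul_self_nonneg _
  exact mul_le_of_le_one_right (frobeniusSq_nonneg B) (mul_le_one₀ hx hy0 hy)

theorem hasOpBound_diagonal {n : ℕ} {v : Fin n → ℝ} {r : ℝ} (h : ∀ i, |v i| ≤ r) (hr : 0 ≤ r) :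
    HasOpBound (Matrix.diagonal v) r := by
  intro x y hx hy
  have h1 : ∀ i, x i * (v i * y i) ≤ r * (x i * x i + y i * y i) / 2 := by
    intro i
    have h2 : x i * (v i * y i) ≤ |v i| * |x i * y i| := by
      rw [← abs_mul]; exact (le_abs_self _).trans_eq (by ring_nf)
    have h3 : |x i * y i| ≤ (x i * x i + y i * y i) / 2 := by
      rw [abs_le]; constructor <;> nlinarith [sq_nonneg (x i + y i), sq_nonneg (x i - y i)]
    nlinarith [mul_le_mul (h i) h3 (abs_nonneg _) hr]
  calc x ⬝ᵥ Matrix.diagonal v *ᵥ y = ∑ i, x i * (v i * y i) := by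
        simp [dotProduct, Matrix.mulVec_diagonal]
    _ ≤ ∑ i, r * (x i * x i + y i * y i) / 2 := Finset.sum_le_sum fun i _ => h1 i
    _ = r * (x ⬝ᵥ x + y ⬝ᵥ y) / 2 := by
        simp only [dotProduct, ← Finset.sum_add_distrib, ← Finset.mul_sum, ← Finset.sum_div]
    _ ≤ r := by nlinarith

/-- Test the form on `u` and the normalized vector `u ᵥ* B`. -/
theorem HasOpBound.sq_vecMul_le {n : ℕ} {B : Matrix (Fin n) (Fin n) ℝ} {κ : ℝ}
    (h : HasOpBound B κ) {u : Fin n → ℝ} (hu : u ⬝ᵥ u ≤ 1) :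
    (u ᵥ* B) ⬝ᵥ (u ᵥ* B) ≤ κ ^ 2 := by
  set w := u ᵥ* B
  have hw0 : 0 ≤ w ⬝ᵥ w := Finset.sum_nonneg fun i _ => mul_self_nonneg _
  rcases hw0.eq_or_lt with h0 | h0
  · rw [← h0]; positivity
  set s := √(w ⬝ᵥ w)
  have hs : 0 < s := Real.sqrt_pos.2 h0
  have hss : s * s = w ⬝ᵥ w := Real.mul_self_sqrt hw0
  have h1 := h u (s⁻¹ • w) hu (by
    rw [smul_dotProduct, dotProduct_smul, ← hss, smul_eq_mul, smul_eq_mul]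
    field_simp; exact le_refl _)
  rw [Matrix.dotProduct_mulVec, dotProduct_smul, ← hss, smul_eq_mul, ← mul_assoc,
    inv_mul_cancel₀ hs.ne', one_mul] at h1
  rw [← hss, sq]
  exact mul_self_le_mul_self hs.le h1

/-- The Frobenius pairing of a low-rank matrix with a matrix of small spectral norm. -/
theorem HasOpBound.sq_sum_mul_le {n r : ℕ} {D B : Matrix (Fin n) (Fin n) ℝ} {κ : ℝ}
    (h : HasOpBound B κ) (hr : D.rank ≤ r) :
    (∑ i, ∑ j, D i j * B i j) ^ 2 ≤ r * κ ^ 2 * frobeniusSq D := by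
  classical
  let col : Fin n → EuclideanSpace ℝ (Fin n) := fun j => WithLp.toLp 2 (D.col j)
  let colB : Fin n → EuclideanSpace ℝ (Fin n) := fun j => WithLp.toLp 2 (B.col j)
  let V : Submodule ℝ (EuclideanSpace ℝ (Fin n)) := Submodule.span ℝ (Set.range col)
  have hV : Module.finrank ℝ V = D.rank := by
    rw [Matrix.rank_eq_finrank_span_cols]
    have : V = (Submodule.span ℝ (Set.range D.col)).map
        ((WithLp.linearEquiv 2 ℝ (Fin n → ℝ)).symm : (Fin n → ℝ) →ₗ[ℝ] _) := by
      rw [Submodule.map_span, ← Set.range_comp]; rfl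
    rw [this]
    exact LinearEquiv.finrank_map_eq _ _
  -- Expanding the columns of `D` in an orthonormal basis of the column space leaves `rank D` row
  -- vectors `bᵀB`, each of squared norm at most `κ²`; Cauchy–Schwarz finishes.
  let b := stdOrthonormalBasis ℝ V
  let v : Fin n → V := fun j => ⟨col j, Submodule.subset_span ⟨j, rfl⟩⟩
  have hinner : ∀ x y : EuclideanSpace ℝ (Fin n), inner ℝ x y = ∑ i, x i * y i := by
    intro x y
    simp [PiLp.inner_apply, mul_comm]
  have hpair : ∀ j, ∑ i, D i j * B i j =
      ∑ a, inner ℝ (v j) (b a) * inner ℝ (b a : EuclideanSpace ℝ (Fin n)) (colB j) := by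
    intro j
    have h1 : ∑ i, D i j * B i j = inner ℝ (v j : EuclideanSpace ℝ (Fin n)) (colB j) := by
      rw [hinner]; rfl
    have h2 : (v j : EuclideanSpace ℝ (Fin n)) = ∑ a, inner ℝ (b a) (v j) • (b a : EuclideanSpace ℝ (Fin n)) := by
      conv_lhs => rw [← b.sum_repr' (v j)]
      simp
    rw [h1, h2, sum_inner]
    refine Finset.sum_congr rfl fun a _ => ?_
    rw [real_inner_smul_left, real_inner_comm]
  have hcols : ∑ j, ∑ a, inner ℝ (v j) (b a) ^ 2 = frobeniusSq D := by
    rw [show frobeniusSq D = ∑ j, ∑ i, D i j ^ 2 from Finset.sum_comm]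
    refine Finset.sum_congr rfl fun j _ => ?_
    have h1 := b.sum_inner_mul_inner (v j) (v j)
    have h2 : inner ℝ (v j) (v j) = ∑ i, D i j * D i j := hinner (v j) (v j)
    rw [h2] at h1
    simp only [sq]
    rw [← h1]
    refine Finset.sum_congr rfl fun a _ => ?_
    rw [real_inner_comm (v j) (b a)]
  have hB : ∑ a, ∑ j, inner ℝ (b a : EuclideanSpace ℝ (Fin n)) (colB j) ^ 2 ≤ r * κ ^ 2 := by
    have h1 : ∀ a, ∑ j, inner ℝ (b a : EuclideanSpace ℝ (Fin n)) (colB j) ^ 2 ≤ κ ^ 2 := by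
      intro a
      have hu : (WithLp.ofLp (b a : EuclideanSpace ℝ (Fin n))) ⬝ᵥ
          (WithLp.ofLp (b a : EuclideanSpace ℝ (Fin n))) ≤ 1 := by
        have h2 := real_inner_self_eq_norm_sq (b a : EuclideanSpace ℝ (Fin n))
        have h3 : ‖(b a : EuclideanSpace ℝ (Fin n))‖ = 1 := b.norm_eq_one a
        rw [hinner, h3] at h2
        exact (h2.trans (one_pow 2)).le
      refine le_trans (le_of_eq ?_) (h.sq_vecMul_le hu)
      simp only [dotProduct, ← sq]
      refine Finset.sum_congr rfl fun j _ => ?_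
      rw [hinner]; rfl
    calc _ ≤ ∑ _a : Fin (Module.finrank ℝ V), κ ^ 2 := Finset.sum_le_sum fun a _ => h1 a
      _ = Module.finrank ℝ V * κ ^ 2 := by simp
      _ ≤ r * κ ^ 2 := by
        rw [hV]
        exact mul_le_mul_of_nonneg_right (by exact_mod_cast hr) (sq_nonneg _)
  rw [Finset.sum_comm, Finset.sum_congr rfl fun j _ => hpair j,
    ← Fintype.sum_prod_type' fun j a => inner ℝ (v j) (b a) *
      inner ℝ (b a : EuclideanSpace ℝ (Fin n)) (colB j)]
  refine (Finset.sum_mul_sq_le_sq_mul_sq _ _ _).trans ?_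
  rw [Fintype.sum_prod_type, Fintype.sum_prod_type_right, hcols, mul_comm]
  exact mul_le_mul_of_nonneg_right hB (frobeniusSq_nonneg D)

theorem rank_sub_le_add {n : ℕ} (X Y : Matrix (Fin n) (Fin n) ℝ) :
    (X - Y).rank ≤ X.rank + Y.rank := by
  have h : LinearMap.range (X - Y).mulVecLin ≤
      LinearMap.range X.mulVecLin ⊔ LinearMap.range Y.mulVecLin := by
    rintro _ ⟨v, rfl⟩
    rw [Matrix.mulVecLin_apply, Matrix.sub_mulVec]
    exact Submodule.sub_mem_sup ⟨v, rfl⟩ ⟨v, rfl⟩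
  exact (Submodule.finrank_mono h).trans (Submodule.finrank_add_le_finrank_add_finrank _ _)

/-- The best rank-`k` approximation of `B` is close to every rank-`k` matrix close to `B`. -/
theorem IsBestRankApprox.frobeniusSq_sub_le {n k : ℕ} {B X Y : Matrix (Fin n) (Fin n) ℝ} {κ : ℝ}
    (hX : IsBestRankApprox k B X) (hY : Y.rank ≤ k) (h : HasOpBound (B - Y) κ) :
    frobeniusSq (X - Y) ≤ 8 * k * κ ^ 2 := by
  have hrank : (X - Y).rank ≤ 2 * k := by
    have := rank_sub_le_add X Y
    have := hX.1
    omega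
  have h1 := h.sq_sum_mul_le hrank
  have h2 := hX.2 Y hY
  have h3 : frobeniusSq (B - X) = frobeniusSq (B - Y) -
      2 * (∑ i, ∑ j, (X - Y) i j * (B - Y) i j) + frobeniusSq (X - Y) := by
    simp only [frobeniusSq, Finset.mul_sum, ← Finset.sum_sub_distrib, ← Finset.sum_add_distrib,
      Matrix.sub_apply]
    exact Finset.sum_congr rfl fun i _ => Finset.sum_congr rfl fun j _ => by ring
  set s := ∑ i, ∑ j, (X - Y) i j * (B - Y) i j
  set D := frobeniusSq (X - Y)
  have hD : 0 ≤ D := frobeniusSq_nonneg _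
  -- Minimality of `X`. With `s² ≤ 2kκ² D`, cancelling one factor `D` gives `D ≤ 8kκ²`.
  have h4 : D ≤ 2 * s := by linarith
  rcases hD.eq_or_lt with h0 | h0
  · rw [← h0]; positivity
  push_cast at h1
  nlinarith

/-! ### The lattice net of the unit ball -/

/-- The integer vectors of squared norm at most `16 n`. Scaled by `(4 √n)⁻¹` they form a net of
the unit ball. -/
noncomputable def latticeBall (n : ℕ) : Finset (Fin n → ℤ) :=
  (Fintype.piFinset fun _ => Finset.Icc (-(16 * n : ℤ)) (16 * n)).filter
    fun f => ∑ i, f i ^ 2 ≤ 16 * n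

theorem mem_latticeBall {n : ℕ} {f : Fin n → ℤ} : f ∈ latticeBall n ↔ ∑ i, f i ^ 2 ≤ 16 * n := by
  simp only [latticeBall, Finset.mem_filter, Fintype.mem_piFinset, Finset.mem_Icc,
    and_iff_right_iff_imp]
  intro h i
  have h1 : f i ^ 2 ≤ 16 * n :=
    (Finset.single_le_sum (f := fun i => f i ^ 2) (fun j _ => sq_nonneg _) (Finset.mem_univ i)).trans h
  constructor <;> nlinarith [sq_nonneg (f i - 1), sq_nonneg (f i + 1)]

theorem sum_exp_neg_abs_le (N : ℕ) :
    ∑ m ∈ Finset.Icc (-(N : ℤ)) N, Real.exp (-|(m : ℝ)|) ≤ Real.exp 2 := by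
  classical
  have hsub : Finset.Icc (-(N : ℤ)) N ⊆ (Finset.range (N + 1)).image (fun k : ℕ => (k : ℤ)) ∪
      (Finset.range (N + 1)).image (fun k : ℕ => -(k : ℤ)) := by
    intro m hm
    rw [Finset.mem_Icc] at hm
    simp only [Finset.mem_union, Finset.mem_image, Finset.mem_range]
    rcases le_total 0 m with h | h
    · exact Or.inl ⟨m.toNat, by omega, by omega⟩
    · exact Or.inr ⟨(-m).toNat, by omega, by omega⟩
  have hgeom : ∀ K : ℕ, ∑ k ∈ Finset.range K, Real.exp (-(k : ℝ)) ≤ 2 - 2 * Real.exp (-(K : ℝ)) := by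
    intro K
    induction K with
    | zero => simp
    | succ K ih =>
      rw [Finset.sum_range_succ]
      have h1 : Real.exp (-((K + 1 : ℕ) : ℝ)) = Real.exp (-(K : ℝ)) * Real.exp (-1) := by
        rw [← Real.exp_add]; push_cast; ring_nf
      have h2 : Real.exp (-1) ≤ 1 / 2 := by
        rw [Real.exp_neg, inv_eq_one_div]
        exact one_div_le_one_div_of_le two_pos (by linarith [Real.add_one_le_exp (1 : ℝ)])
      have h3 := Real.exp_pos (-(K : ℝ))
      rw [h1]
      nlinarith
  have hK := hgeom (N + 1)
  have hpos := Real.exp_pos (-((N + 1 : ℕ) : ℝ))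
  have he : (4 : ℝ) ≤ Real.exp 2 := by
    have h1 : Real.exp 2 = Real.exp 1 * Real.exp 1 := by rw [← Real.exp_add]; norm_num
    have := Real.add_one_le_exp (1 : ℝ)
    nlinarith
  have himg : ∀ g : ℕ → ℤ, (∀ k, |(g k : ℝ)| = k) → Function.Injective g →
      ∑ m ∈ (Finset.range (N + 1)).image g, Real.exp (-|(m : ℝ)|) ≤ 2 := by
    intro g hg hinj
    rw [Finset.sum_image fun a _ b _ h => hinj h]
    simp only [hg]
    linarith
  calc _ ≤ _ := Finset.sum_le_sum_of_subset_of_nonneg hsub fun _ _ _ => (Real.exp_pos _).le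
    _ ≤ _ := Finset.sum_union_inter (f := fun m : ℤ => Real.exp (-|(m : ℝ)|)) |>.le |>.trans' <|
        le_add_of_nonneg_right <| Finset.sum_nonneg fun _ _ => (Real.exp_pos _).le
    _ ≤ 2 + 2 := add_le_add (himg _ (fun k => by simp) Nat.cast_injective)
        (himg _ (fun k => by simp) fun a b h => by simpa using h)
    _ ≤ Real.exp 2 := by linarith

/-- An exponential-weight count: since `|m| ≤ m²` on integers, every `f` in the ball has `exp (16 n)
∏ exp (-|f i|) ≥ 1`, and the sum of these weights over the surrounding box factors into
one-dimensional sums. -/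
theorem card_latticeBall_le (n : ℕ) : ((latticeBall n).card : ℝ) ≤ Real.exp (18 * n) := by
  classical
  calc ((latticeBall n).card : ℝ) = ∑ f ∈ latticeBall n, (1 : ℝ) := by simp
    _ ≤ ∑ f ∈ latticeBall n, Real.exp (16 * n) * ∏ i, Real.exp (-|(f i : ℝ)|) := by
        refine Finset.sum_le_sum fun f hf => ?_
        rw [← Real.exp_sum, ← Real.exp_add]
        refine Real.one_le_exp ?_
        have h1 : ∑ i, |(f i : ℝ)| ≤ ∑ i, ((f i : ℝ)) ^ 2 := by
          refine Finset.sum_le_sum fun i _ => ?_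
          have h2 : |f i| ≤ f i ^ 2 := by
            rw [← sq_abs]
            nlinarith [abs_nonneg (f i), Int.le_self_sq |f i|]
          exact_mod_cast h2
        have h3 : ∑ i, ((f i : ℝ)) ^ 2 ≤ 16 * n := by exact_mod_cast mem_latticeBall.1 hf
        rw [Finset.sum_neg_distrib]
        linarith
    _ ≤ ∑ f ∈ Fintype.piFinset fun _ : Fin n => Finset.Icc (-((16 * n : ℕ) : ℤ)) (16 * n : ℕ),
          Real.exp (16 * n) * ∏ i, Real.exp (-|(f i : ℝ)|) := by
        refine Finset.sum_le_sum_of_subset_of_nonneg ?_ fun _ _ _ => by positivity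
        rw [latticeBall]
        push_cast
        exact Finset.filter_subset _ _
    _ = Real.exp (16 * n) * ∏ _i : Fin n,
          ∑ m ∈ Finset.Icc (-((16 * n : ℕ) : ℤ)) (16 * n : ℕ), Real.exp (-|(m : ℝ)|) := by
        rw [← Finset.mul_sum, Finset.prod_univ_sum]
    _ ≤ Real.exp (16 * n) * ∏ _i : Fin n, Real.exp 2 := by
        gcongr with i _
        exact sum_exp_neg_abs_le _
    _ = Real.exp (18 * n) := by
        rw [Finset.prod_const, Finset.card_univ, Fintype.card_fin, ← Real.exp_nat_mul,
          ← Real.exp_add]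
        ring_nf

theorem exists_int_near (x : ℝ) : ∃ m : ℤ, (m : ℝ) ^ 2 ≤ x ^ 2 ∧ (x - m) ^ 2 ≤ 1 := by
  rcases le_total 0 x with h | h
  · have h1 := Int.floor_le x
    have h2 := Int.lt_floor_add_one x
    have h3 : (0 : ℝ) ≤ ⌊x⌋ := by exact_mod_cast Int.floor_nonneg.2 h
    exact ⟨⌊x⌋, by nlinarith, by nlinarith⟩
  · have h1 := Int.le_ceil x
    have h2 := Int.ceil_lt_add_one x
    have h3 : (⌈x⌉ : ℝ) ≤ 0 := by exact_mod_cast Int.ceil_le.2 (by simpa using h)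
    exact ⟨⌈x⌉, by nlinarith, by nlinarith⟩

/-- Round `4√n x` towards zero in each coordinate: norms do not grow, and the error has norm at most
`√n`, a quarter of the scale. -/
theorem exists_latticeBall_near {n : ℕ} (hn : 0 < n) {x : Fin n → ℝ} (hx : x ⬝ᵥ x ≤ 1) :
    ∃ f ∈ latticeBall n, ∃ z : Fin n → ℝ, z ⬝ᵥ z ≤ 1 ∧
      x = (4 * √n)⁻¹ • (fun i => (f i : ℝ)) + (1 / 4 : ℝ) • z := by
  have hn' : (0 : ℝ) < n := by exact_mod_cast hn
  set s := √(n : ℝ)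
  have hs : 0 < s := Real.sqrt_pos.2 hn'
  have hss : s ^ 2 = n := Real.sq_sqrt hn'.le
  choose f hf1 hf2 using fun i => exists_int_near (4 * s * x i)
  simp only [dotProduct, ← sq] at hx ⊢
  refine ⟨f, ?_, fun i => s⁻¹ * (4 * s * x i - f i), ?_, ?_⟩
  · rw [mem_latticeBall]
    have : ∑ i, (f i : ℝ) ^ 2 ≤ 16 * n := by
      calc ∑ i, (f i : ℝ) ^ 2 ≤ ∑ i, (4 * s * x i) ^ 2 := Finset.sum_le_sum fun i _ => hf1 i
        _ = 16 * n * ∑ i, x i ^ 2 := by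
            rw [Finset.mul_sum]
            exact Finset.sum_congr rfl fun i _ => by rw [mul_pow, mul_pow, hss]; ring
        _ ≤ 16 * n := by nlinarith
    exact_mod_cast this
  · calc ∑ i, (s⁻¹ * (4 * s * x i - f i)) ^ 2 ≤ ∑ _i : Fin n, (n : ℝ)⁻¹ := by
          refine Finset.sum_le_sum fun i _ => ?_
          rw [mul_pow, inv_pow, hss]
          exact mul_le_of_le_one_right (by positivity) (hf2 i)
      _ = 1 := by simp [hn'.ne']
  · ext i
    simp only [Pi.add_apply, Pi.smul_apply, smul_eq_mul]
    field_simp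
    ring

/-- The spectral norm of a matrix is controlled by its bilinear form on the lattice net. -/
theorem hasOpBound_of_latticeBall {n : ℕ} (hn : 0 < n) {B : Matrix (Fin n) (Fin n) ℝ} {K : ℝ}
    (h : ∀ f ∈ latticeBall n, ∀ g ∈ latticeBall n, ∑ i, ∑ j, B i j * ((f i : ℝ) * g j) ≤ K) :
    HasOpBound B (K / (8 * n)) := by
  have hn' : (0 : ℝ) < n := by exact_mod_cast hn
  have hss : √(n : ℝ) * √n = n := Real.mul_self_sqrt hn'.le
  -- The supremum of the form is finite by the Frobenius bound. Replacing both arguments by net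
  -- points costs a quarter of it each, so half of it can be absorbed.
  let S : Set ℝ := {r | ∃ x y : Fin n → ℝ, x ⬝ᵥ x ≤ 1 ∧ y ⬝ᵥ y ≤ 1 ∧ r = x ⬝ᵥ B *ᵥ y}
  have hbdd : BddAbove S := by
    refine ⟨√(frobeniusSq B), ?_⟩
    rintro _ ⟨x, y, hx, hy, rfl⟩
    exact hasOpBound_of_frobeniusSq_le (Real.sqrt_nonneg _)
      (Real.sq_sqrt (frobeniusSq_nonneg B)).ge x y hx hy
  have hle : ∀ x y : Fin n → ℝ, x ⬝ᵥ x ≤ 1 → y ⬝ᵥ y ≤ 1 → x ⬝ᵥ B *ᵥ y ≤ sSup S :=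
    fun x y hx hy => le_csSup hbdd ⟨x, y, hx, hy, rfl⟩
  have hhalf : ∀ x y : Fin n → ℝ, x ⬝ᵥ x ≤ 1 → y ⬝ᵥ y ≤ 1 →
      x ⬝ᵥ B *ᵥ y ≤ K / (16 * n) + sSup S / 2 := by
    intro x y hx hy
    obtain ⟨f, hf, z, hz, hxz⟩ := exists_latticeBall_near hn hx
    obtain ⟨g, hg, w, hw, hyw⟩ := exists_latticeBall_near hn hy
    set F : Fin n → ℝ := (4 * √n)⁻¹ • fun i => (f i : ℝ)
    set G : Fin n → ℝ := (4 * √n)⁻¹ • fun i => (g i : ℝ)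
    have hF : F ⬝ᵥ F ≤ 1 := by
      have h1 : ∑ i, ((f i : ℝ)) ^ 2 ≤ 16 * n := by exact_mod_cast mem_latticeBall.1 hf
      have h2 : F ⬝ᵥ F = (16 * n : ℝ)⁻¹ * ∑ i, ((f i : ℝ)) ^ 2 := by
        rw [smul_dotProduct, dotProduct_smul, smul_smul, ← mul_inv,
          show 4 * √(n : ℝ) * (4 * √n) = 16 * n by linear_combination 16 * hss]
        simp [dotProduct, sq]
      rw [h2, inv_mul_le_iff₀ (by positivity)]
      linarith
    have hFG : F ⬝ᵥ B *ᵥ G ≤ K / (16 * n) := by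
      rw [smul_dotProduct, Matrix.mulVec_smul, dotProduct_smul, smul_smul, ← mul_inv,
        show 4 * √(n : ℝ) * (4 * √n) = 16 * n by linear_combination 16 * hss, smul_eq_mul,
        inv_mul_eq_div]
      refine div_le_div_of_nonneg_right (le_trans (le_of_eq ?_) (h f hf g hg)) (by positivity)
      simp only [dotProduct, Matrix.mulVec, Finset.mul_sum]
      exact Finset.sum_congr rfl fun i _ => Finset.sum_congr rfl fun j _ => by ring
    have e1 : x ⬝ᵥ B *ᵥ y = F ⬝ᵥ B *ᵥ y + 1 / 4 * (z ⬝ᵥ B *ᵥ y) := by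
      conv_lhs => rw [hxz, add_dotProduct, smul_dotProduct (1 / 4 : ℝ) z, smul_eq_mul]
    have e2 : F ⬝ᵥ B *ᵥ y = F ⬝ᵥ B *ᵥ G + 1 / 4 * (F ⬝ᵥ B *ᵥ w) := by
      conv_lhs => rw [hyw, Matrix.mulVec_add, dotProduct_add, Matrix.mulVec_smul B (1 / 4 : ℝ) w,
        dotProduct_smul (1 / 4 : ℝ), smul_eq_mul]
    rw [e1, e2]
    linarith [hle F w hF hw, hle z y hz hy]
  have hS : sSup S ≤ K / (16 * n) + sSup S / 2 := by
    refine csSup_le ⟨_, 0, 0, by simp, by simp, rfl⟩ ?_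
    rintro _ ⟨x, y, hx, hy, rfl⟩
    exact hhalf x y hx hy
  intro x y hx hy
  refine (hle x y hx hy).trans ?_
  have : K / (8 * n) = 2 * (K / (16 * n)) := by field_simp; ring
  linarith

/-! ### Scales, rates and union-bound costs -/

/-- The scales `l` for which an integer vector in the lattice ball may have an entry `≥ 4 ^ l`. -/
def dyadicLevels (n : ℕ) : Finset ℕ :=
  (Finset.range (16 * n + 1)).filter fun l => 16 ^ l ≤ 16 * n

theorem mem_dyadicLevels {n l : ℕ} : l ∈ dyadicLevels n ↔ 16 ^ l ≤ 16 * n := by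
  simp only [dyadicLevels, Finset.mem_filter, Finset.mem_range, and_iff_right_iff_imp]
  intro h
  have : l < 16 ^ l := Nat.lt_pow_self (by norm_num)
  omega

open Classical in
/-- The pairs of scales which are neither light nor controlled by the degrees. -/
noncomputable def heavyScales (n : ℕ) (δ : ℝ) : Finset (ℕ × ℕ) :=
  (dyadicLevels n ×ˢ dyadicLevels n).filter fun p =>
    δ < 4 * (2 ^ p.1 * 2 ^ p.2) ∧ 2 ^ p.2 < 2 * (2 ^ p.1 * δ) ∧ 2 ^ p.1 < 2 * (2 ^ p.2 * δ)

theorem mem_heavyScales {n : ℕ} {δ : ℝ} {l m : ℕ} : (l, m) ∈ heavyScales n δ ↔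
    (l ∈ dyadicLevels n ∧ m ∈ dyadicLevels n) ∧
      δ < 4 * (2 ^ l * 2 ^ m) ∧ 2 ^ m < 2 * (2 ^ l * δ) ∧ 2 ^ l < 2 * (2 ^ m * δ) := by
  simp [heavyScales]

theorem swap_mem_heavyScales {n : ℕ} {δ : ℝ} {l m : ℕ} (h : (l, m) ∈ heavyScales n δ) :
    (m, l) ∈ heavyScales n δ := by
  rw [mem_heavyScales] at h ⊢
  refine ⟨h.1.symm, ?_, h.2.2.2, h.2.2.1⟩
  rw [mul_comm ((2 : ℝ) ^ m)]
  exact h.2.1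

/-- The exponent in the discrepancy bound at a given pair of scales. -/
noncomputable def heavyRate (δ : ℝ) (l m : ℕ) : ℝ :=
  1 / 2 + Real.log (4 * (2 ^ l * 2 ^ m) / δ)

theorem heavyRate_comm (δ : ℝ) (l m : ℕ) : heavyRate δ l m = heavyRate δ m l := by
  rw [heavyRate, heavyRate, mul_comm ((2 : ℝ) ^ l)]

/-- The price of a union bound over the sets of size `s` occurring at the scale `l`. -/
noncomputable def scaleCost (n l : ℕ) (s : ℝ) : ℝ := 4 * l * s + n * Real.exp (-(4 * l))

theorem half_le_heavyRate {n : ℕ} {δ : ℝ} (hδ : 1 ≤ δ) {l m : ℕ} (h : (l, m) ∈ heavyScales n δ) :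
    1 / 2 ≤ heavyRate δ l m := by
  have h1 := (mem_heavyScales.1 h).2.1
  have : 0 ≤ Real.log (4 * (2 ^ l * 2 ^ m) / δ) :=
    Real.log_nonneg ((one_le_div (by linarith)).2 h1.le)
  rw [heavyRate]
  linarith

/-- The rate is chosen for this: the mean term at scales `(l, m)` picks up a second factor `4^l
4^m`, and the product becomes `16^l 16^m`, matching the squared norms of the test vectors. -/
theorem exp_two_mul_heavyRate_le {δ : ℝ} (hδ : 1 ≤ δ) (l m : ℕ) :
    Real.exp (2 * heavyRate δ l m) ≤ 48 * (4 ^ l * 4 ^ m) / δ ^ 2 := by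
  have hδ0 : 0 < δ := by linarith
  have hu : 0 < 4 * ((2 : ℝ) ^ l * 2 ^ m) / δ := by positivity
  have h1 : Real.exp (2 * heavyRate δ l m) = Real.exp 1 * (4 * (2 ^ l * 2 ^ m) / δ) ^ 2 := by
    rw [heavyRate, mul_add, Real.exp_add, two_mul (Real.log _), Real.exp_add, Real.exp_log hu]
    norm_num [sq]
  have h2 : (4 * ((2 : ℝ) ^ l * 2 ^ m) / δ) ^ 2 = 16 * (4 ^ l * 4 ^ m) / δ ^ 2 := by
    rw [div_pow, mul_pow, mul_pow, ← pow_mul, ← pow_mul, mul_comm l, mul_comm m, pow_mul, pow_mul]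
    norm_num
  rw [h1, h2]
  have h3 : Real.exp 1 ≤ 3 := Real.exp_one_lt_three.le
  calc Real.exp 1 * (16 * (4 ^ l * 4 ^ m) / δ ^ 2) ≤ 3 * (16 * (4 ^ l * 4 ^ m) / δ ^ 2) := by gcongr
    _ = _ := by ring

/-- The factor `1 + l` from the union bound must be absorbed by the rate or by the gap between the
scales. If `δ ≤ 4 · 2^m`, the logarithm in the rate is at least of order `l`; otherwise `2^m ≤ δ /
4` and `1 + l ≤ 2^l` suffices. -/
theorem add_one_mul_le_heavyRate {n : ℕ} {δ : ℝ} (hδ : 1 ≤ δ) {l m : ℕ}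
    (h : (l, m) ∈ heavyScales n δ) :
    (1 + l) * 2 ^ m ≤ 4 * heavyRate δ l m * (2 ^ l * δ) := by
  have hδ0 : 0 < δ := by linarith
  have ht := half_le_heavyRate hδ h
  obtain ⟨-, h1, h2, -⟩ := mem_heavyScales.1 h
  have hl : (1 : ℝ) + l ≤ 2 ^ l := by exact_mod_cast (by have := Nat.lt_two_pow_self (n := l); omega : 1 + l ≤ 2 ^ l)
  have h2l : (0 : ℝ) < 2 ^ l := by positivity
  have h2m : (0 : ℝ) < 2 ^ m := by positivity
  rcases le_total (2 ^ l) (4 * ((2 : ℝ) ^ l * 2 ^ m) / δ) with hu | hu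
  · have h3 : (l : ℝ) / 2 ≤ Real.log (4 * (2 ^ l * 2 ^ m) / δ) := by
      refine le_trans ?_ (Real.log_le_log h2l hu)
      rw [Real.log_pow]
      nlinarith [Real.log_two_gt_d9, (Nat.cast_nonneg l : (0 : ℝ) ≤ l)]
    have h4 : (1 + l : ℝ) ≤ 2 * heavyRate δ l m := by rw [heavyRate]; linarith
    calc (1 + l : ℝ) * 2 ^ m ≤ (2 * heavyRate δ l m) * (2 * (2 ^ l * δ)) := by gcongr
      _ = _ := by ring
  · rw [div_le_iff₀ hδ0] at hu
    have h5 : 4 * (2 : ℝ) ^ m ≤ δ := by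
      by_contra! hc
      nlinarith
    calc (1 + l : ℝ) * 2 ^ m ≤ 2 ^ l * δ := by
          refine mul_le_mul hl ?_ h2m.le h2l.le
          linarith
      _ ≤ 4 * heavyRate δ l m * (2 ^ l * δ) := le_mul_of_one_le_left (by positivity) (by linarith)

theorem sum_pow_le_two_mul {r X : ℝ} (hr : 2 ≤ r) (hX : 0 ≤ X) (S : Finset ℕ)
    (h : ∀ m ∈ S, r ^ m ≤ X) : ∑ m ∈ S, r ^ m ≤ 2 * X := by
  rcases S.eq_empty_or_nonempty with rfl | hS
  · simpa using hX
  have h1 : ∀ K : ℕ, ∑ m ∈ Finset.range (K + 1), r ^ m ≤ 2 * r ^ K := by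
    intro K
    induction K with
    | zero => norm_num
    | succ K ih =>
      rw [Finset.sum_range_succ, pow_succ]
      have : 0 ≤ r ^ K := by positivity
      nlinarith
  calc ∑ m ∈ S, r ^ m ≤ ∑ m ∈ Finset.range (S.max' hS + 1), r ^ m := by
        refine Finset.sum_le_sum_of_subset_of_nonneg (fun m hm => ?_) fun _ _ _ => by positivity
        exact Finset.mem_range.2 (Nat.lt_succ_of_le (S.le_max' m hm))
    _ ≤ 2 * r ^ S.max' hS := h1 _
    _ ≤ 2 * X := by linarith [h _ (S.max'_mem hS)]

theorem sum_heavyScales_eq (n : ℕ) (δ : ℝ) (F : ℕ → ℕ → ℝ) :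
    ∑ p ∈ heavyScales n δ, F p.1 p.2 = ∑ l ∈ dyadicLevels n,
      ∑ m ∈ (dyadicLevels n).filter (fun m => (l, m) ∈ heavyScales n δ), F l m := by
  classical
  simp only [Finset.sum_filter]
  rw [← Finset.sum_product' (f := fun l m => if (l, m) ∈ heavyScales n δ then F l m else 0),
    ← Finset.sum_filter]
  refine Finset.sum_congr ?_ fun _ _ => rfl
  ext ⟨l, m⟩
  simp only [Finset.mem_filter, Finset.mem_product]
  exact ⟨fun h => ⟨(mem_heavyScales.1 h).1, h⟩, fun h => h.2⟩

theorem sum_heavyScales_swap (n : ℕ) (δ : ℝ) (F : ℕ → ℕ → ℝ) :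
    ∑ p ∈ heavyScales n δ, F p.2 p.1 = ∑ p ∈ heavyScales n δ, F p.1 p.2 := by
  refine Finset.sum_nbij' Prod.swap Prod.swap ?_ ?_ ?_ ?_ ?_
  · exact fun p hp => swap_mem_heavyScales hp
  · exact fun p hp => swap_mem_heavyScales hp
  all_goals simp

/-- For fixed `l` the weights `4^m` form a geometric sum capped by `4 · 4^l δ²`; the resulting
`16^l` are capped by `16 n`. -/
theorem sum_heavyScales_weight_le {n : ℕ} {δ : ℝ} (hδ : 1 ≤ δ) :
    ∑ p ∈ heavyScales n δ, (4 : ℝ) ^ p.1 * 4 ^ p.2 ≤ 256 * (n * δ ^ 2) := by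
  rw [sum_heavyScales_eq n δ fun l m => (4 : ℝ) ^ l * 4 ^ m]
  have h1 : ∀ l ∈ dyadicLevels n,
      ∑ m ∈ (dyadicLevels n).filter (fun m => (l, m) ∈ heavyScales n δ), (4 : ℝ) ^ l * 4 ^ m ≤
        16 ^ l * (8 * δ ^ 2) := by
    intro l _
    rw [← Finset.mul_sum]
    have h2 := sum_pow_le_two_mul (r := 4) (X := 4 * (4 ^ l * δ ^ 2)) (by norm_num) (by positivity)
      ((dyadicLevels n).filter (fun m => (l, m) ∈ heavyScales n δ)) fun m hm => by
        have h3 := (mem_heavyScales.1 (Finset.mem_filter.1 hm).2).2.2.1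
        have h4 : ((2 : ℝ) ^ m) ^ 2 ≤ (2 * (2 ^ l * δ)) ^ 2 := by gcongr
        have e : ∀ k : ℕ, ((2 : ℝ) ^ k) ^ 2 = 4 ^ k := fun k => by
          rw [← pow_mul, mul_comm, pow_mul]; norm_num
        rw [mul_pow, mul_pow, e, e] at h4
        linarith
    calc (4 : ℝ) ^ l * _ ≤ 4 ^ l * (2 * (4 * (4 ^ l * δ ^ 2))) := by gcongr
      _ = (4 * 4) ^ l * (8 * δ ^ 2) := by rw [mul_pow]; ring
      _ = _ := by norm_num
  refine (Finset.sum_le_sum h1).trans ?_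
  rw [← Finset.sum_mul]
  have h2 := sum_pow_le_two_mul (r := 16) (X := 16 * n) (by norm_num) (by positivity)
    (dyadicLevels n) fun l hl => by exact_mod_cast mem_dyadicLevels.1 hl
  calc _ ≤ (2 * (16 * n : ℝ)) * (8 * δ ^ 2) := by gcongr
    _ = _ := by ring

theorem sum_sixteen_pow_mul_exp_le (S : Finset ℕ) :
    ∑ l ∈ S, (16 : ℝ) ^ l * Real.exp (-(4 * l)) ≤ 2 := by
  -- This is why the cost decays like `exp (-4l)`: it beats the weight `16^l`.
  have h0 : 16 * Real.exp (-4) ≤ 1 / 2 := by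
    have h1 : Real.exp 4 = Real.exp 1 ^ 4 := by rw [← Real.exp_nat_mul]; norm_num
    have h2 : (2.7 : ℝ) ^ 4 ≤ Real.exp 1 ^ 4 := by
      gcongr
      linarith [Real.exp_one_gt_d9]
    rw [Real.exp_neg, ← div_eq_mul_inv, div_le_iff₀ (Real.exp_pos _), h1]
    norm_num at h2 ⊢
    linarith
  have h1 : ∀ l : ℕ, (16 : ℝ) ^ l * Real.exp (-(4 * l)) ≤ (1 / 2) ^ l := by
    intro l
    have : Real.exp (-(4 * l)) = Real.exp (-4) ^ l := by rw [← Real.exp_nat_mul]; ring_nf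
    rw [this, ← mul_pow]
    gcongr
  refine (Finset.sum_le_sum fun l _ => h1 l).trans ?_
  exact (summable_geometric_two.sum_le_tsum S fun _ _ => by positivity).trans_eq tsum_geometric_two

/-- Dividing by the rate turns the weight `4^m` into a multiple of `2^m`, up to factors in `l` and
`δ`. Summing over `m` up to `2^m < 2 · 2^l δ` leaves `16^l δ²` times the cost, which the norm
constraint on `s` and the decay of `exp (-4l)` control. -/
theorem sum_scaleCost_le {n : ℕ} {δ : ℝ} (hδ : 1 ≤ δ) {s : ℕ → ℝ} (hs : ∀ l, 0 ≤ s l)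
    (hsum : ∑ l ∈ dyadicLevels n, 16 ^ l * s l ≤ 16 * n) :
    ∑ p ∈ heavyScales n δ, 4 ^ p.1 * 4 ^ p.2 * (scaleCost n p.1 (s p.1) / heavyRate δ p.1 p.2) ≤
      1056 * (n * δ ^ 2) := by
  rw [sum_heavyScales_eq n δ fun l m => 4 ^ l * 4 ^ m * (scaleCost n l (s l) / heavyRate δ l m)]
  have h1 : ∀ l ∈ dyadicLevels n,
      ∑ m ∈ (dyadicLevels n).filter (fun m => (l, m) ∈ heavyScales n δ),
        4 ^ l * 4 ^ m * (scaleCost n l (s l) / heavyRate δ l m) ≤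
      16 * δ ^ 2 * (4 * (16 ^ l * s l) + n * (16 ^ l * Real.exp (-(4 * l)))) := by
    intro l _
    set c := 4 * s l + n * Real.exp (-(4 * l))
    have hc : 0 ≤ c := by have := hs l; positivity
    have e4 : ∀ k : ℕ, (4 : ℝ) ^ k = 2 ^ k * 2 ^ k := fun k => by rw [← mul_pow]; norm_num
    have e16 : ∀ k : ℕ, (16 : ℝ) ^ k = 2 ^ k * 2 ^ k * (2 ^ k * 2 ^ k) := fun k => by
      simp only [← mul_pow]; norm_num
    calc _ ≤ ∑ m ∈ (dyadicLevels n).filter (fun m => (l, m) ∈ heavyScales n δ),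
          4 * (4 ^ l * 2 ^ l) * δ * c * 2 ^ m := by
          refine Finset.sum_le_sum fun m hm => ?_
          have hm' := (Finset.mem_filter.1 hm).2
          have ht := half_le_heavyRate hδ hm'
          have ht0 : 0 < heavyRate δ l m := by linarith
          have hk := add_one_mul_le_heavyRate hδ hm'
          have h3 : scaleCost n l (s l) ≤ (1 + l) * c := by
            have h4 : 0 ≤ n * Real.exp (-(4 * l)) := by positivity
            have h5 : (0 : ℝ) ≤ l := Nat.cast_nonneg l
            simp only [scaleCost, c]
            nlinarith [hs l, mul_nonneg h5 h4]
          rw [← mul_div_assoc, div_le_iff₀ ht0]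
          calc 4 ^ l * 4 ^ m * scaleCost n l (s l) ≤ 4 ^ l * 4 ^ m * ((1 + l) * c) := by gcongr
            _ = 4 ^ l * 2 ^ m * c * ((1 + l) * 2 ^ m) := by rw [e4 m]; ring
            _ ≤ 4 ^ l * 2 ^ m * c * (4 * heavyRate δ l m * (2 ^ l * δ)) := by gcongr
            _ = _ := by ring
      _ ≤ 4 * (4 ^ l * 2 ^ l) * δ * c * (2 * (2 * (2 ^ l * δ))) := by
          rw [← Finset.mul_sum]
          gcongr
          exact sum_pow_le_two_mul le_rfl (by positivity) _ fun m hm =>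
            (mem_heavyScales.1 (Finset.mem_filter.1 hm).2).2.2.1.le
      _ = _ := by rw [e4 l, e16 l]; simp only [c]; ring
  refine (Finset.sum_le_sum h1).trans ?_
  rw [← Finset.mul_sum, Finset.sum_add_distrib, ← Finset.mul_sum, ← Finset.mul_sum]
  have h2 := sum_sixteen_pow_mul_exp_le (dyadicLevels n)
  calc _ ≤ 16 * δ ^ 2 * (4 * (16 * n) + n * 2) := by gcongr
    _ = _ := by ring

/-! ### Level sets and the heavy part -/

/-- The indices at which the vector `a` has the scale `l`. -/
def levelSet {n : ℕ} (a : Fin n → ℕ) (l : ℕ) : Finset (Fin n) :=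
  Finset.univ.filter fun i => a i ≠ 0 ∧ Nat.log 4 (a i) = l

theorem sum_card_levelSet_le {n : ℕ} {a : Fin n → ℕ} (ha : ∑ i, a i ^ 2 ≤ 16 * n) :
    ∑ l ∈ dyadicLevels n, (16 : ℝ) ^ l * (levelSet a l).card ≤ 16 * n := by
  have h : ∑ l ∈ dyadicLevels n, 16 ^ l * (levelSet a l).card ≤ 16 * n := by
    calc ∑ l ∈ dyadicLevels n, 16 ^ l * (levelSet a l).card
        ≤ ∑ l ∈ dyadicLevels n, ∑ i, if Nat.log 4 (a i) = l then a i ^ 2 else 0 := by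
          refine Finset.sum_le_sum fun l _ => ?_
          rw [mul_comm, ← smul_eq_mul, ← Finset.sum_const, levelSet, Finset.sum_filter]
          refine Finset.sum_le_sum fun i _ => ?_
          by_cases h1 : a i = 0
          · simp [h1]
          by_cases h2 : Nat.log 4 (a i) = l
          · simp only [ne_eq, h1, not_false_eq_true, h2, and_self, if_true]
            have h3 : 4 ^ l ≤ a i := h2 ▸ Nat.pow_log_le_self 4 h1
            calc 16 ^ l = (4 ^ l) ^ 2 := by rw [← pow_mul, mul_comm, pow_mul]; norm_num
              _ ≤ a i ^ 2 := Nat.pow_le_pow_left h3 2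
          · simp [h2]
      _ = ∑ i, ∑ l ∈ dyadicLevels n, if Nat.log 4 (a i) = l then a i ^ 2 else 0 :=
          Finset.sum_comm
      _ ≤ ∑ i, a i ^ 2 := by
          refine Finset.sum_le_sum fun i _ => ?_
          rw [Finset.sum_ite_eq]
          split_ifs <;> simp
      _ ≤ 16 * n := ha
  exact_mod_cast h

theorem log_mem_dyadicLevels {n : ℕ} {a : Fin n → ℕ} (ha : ∑ i, a i ^ 2 ≤ 16 * n) {i : Fin n}
    (hi : a i ≠ 0) : Nat.log 4 (a i) ∈ dyadicLevels n := by
  rw [mem_dyadicLevels]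
  calc 16 ^ Nat.log 4 (a i) = (4 ^ Nat.log 4 (a i)) ^ 2 := by
        rw [← pow_mul, mul_comm, pow_mul]; norm_num
    _ ≤ a i ^ 2 := Nat.pow_le_pow_left (Nat.pow_log_le_self 4 hi) 2
    _ ≤ ∑ i, a i ^ 2 := Finset.single_le_sum (f := fun i => a i ^ 2) (fun _ _ => Nat.zero_le _)
        (Finset.mem_univ i)
    _ ≤ 16 * n := ha

/-- If one entry is at least `δ²` times the other, its square over `δ²` dominates the product.
Otherwise the two scales form a heavy pair, and rounding each entry down to a power of 4 loses a
factor below 16. -/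
theorem heavy_entry_le {n : ℕ} {a b : Fin n → ℕ} (ha : ∑ i, a i ^ 2 ≤ 16 * n)
    (hb : ∑ i, b i ^ 2 ≤ 16 * n) {δ : ℝ} (hδ : 1 ≤ δ) (i j : Fin n) :
    (if δ ^ 2 < (a i : ℝ) * b j then (a i : ℝ) * b j else 0) ≤
      (a i : ℝ) ^ 2 / δ ^ 2 + (b j : ℝ) ^ 2 / δ ^ 2 + ∑ p ∈ heavyScales n δ,
        if i ∈ levelSet a p.1 ∧ j ∈ levelSet b p.2 then 16 * ((4 : ℝ) ^ p.1 * 4 ^ p.2) else 0 := by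
  have hδ0 : 0 < δ := by linarith
  have hnn : ∀ p ∈ heavyScales n δ, (0 : ℝ) ≤
      if i ∈ levelSet a p.1 ∧ j ∈ levelSet b p.2 then 16 * ((4 : ℝ) ^ p.1 * 4 ^ p.2) else 0 :=
    fun p _ => by split_ifs <;> positivity
  have hS := Finset.sum_nonneg hnn
  have ha0 : 0 ≤ (a i : ℝ) ^ 2 / δ ^ 2 := by positivity
  have hb0 : 0 ≤ (b j : ℝ) ^ 2 / δ ^ 2 := by positivity
  split_ifs with h
  swap
  · linarith
  rcases le_or_gt ((b j : ℝ) * δ ^ 2) (a i) with h1 | h1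
  · have : (a i : ℝ) * b j ≤ (a i : ℝ) ^ 2 / δ ^ 2 := by
      rw [le_div_iff₀ (by positivity)]
      nlinarith [(Nat.cast_nonneg (a i) : (0 : ℝ) ≤ a i)]
    linarith
  rcases le_or_gt ((a i : ℝ) * δ ^ 2) (b j) with h2 | h2
  · have : (a i : ℝ) * b j ≤ (b j : ℝ) ^ 2 / δ ^ 2 := by
      rw [le_div_iff₀ (by positivity)]
      nlinarith [(Nat.cast_nonneg (b j) : (0 : ℝ) ≤ b j)]
    linarith
  have hai : a i ≠ 0 := by rintro h0; rw [h0] at h; norm_num at h; nlinarith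
  have hbj : b j ≠ 0 := by rintro h0; rw [h0] at h; norm_num at h; nlinarith
  set l := Nat.log 4 (a i) with hl
  set m := Nat.log 4 (b j) with hm
  have e4 : ∀ k : ℕ, (4 : ℝ) ^ k = (2 ^ k) ^ 2 := fun k => by
    rw [← pow_mul, mul_comm, pow_mul]; norm_num
  have hal : (4 : ℝ) ^ l ≤ a i := by exact_mod_cast Nat.pow_log_le_self 4 hai
  have hbm : (4 : ℝ) ^ m ≤ b j := by exact_mod_cast Nat.pow_log_le_self 4 hbj
  have hau : (a i : ℝ) < 4 * 4 ^ l := by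
    have := Nat.lt_pow_succ_log_self (b := 4) (by norm_num) (a i)
    rw [← pow_succ']; exact_mod_cast this
  have hbu : (b j : ℝ) < 4 * 4 ^ m := by
    have := Nat.lt_pow_succ_log_self (b := 4) (by norm_num) (b j)
    rw [← pow_succ']; exact_mod_cast this
  have hab : (a i : ℝ) * b j ≤ 16 * (4 ^ l * 4 ^ m) := by
    calc (a i : ℝ) * b j ≤ (4 * 4 ^ l) * (4 * 4 ^ m) := by gcongr
      _ = _ := by ring
  have hmem : (l, m) ∈ heavyScales n δ := by
    refine mem_heavyScales.2 ⟨⟨log_mem_dyadicLevels ha hai, log_mem_dyadicLevels hb hbj⟩,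
      ?_, ?_, ?_⟩
    · refine lt_of_pow_lt_pow_left₀ 2 (by positivity) ?_
      rw [mul_pow, mul_pow, ← e4, ← e4]
      linarith
    · refine lt_of_pow_lt_pow_left₀ 2 (by positivity) ?_
      rw [mul_pow, mul_pow, ← e4, ← e4]
      have : (a i : ℝ) * δ ^ 2 < 4 * 4 ^ l * δ ^ 2 := by gcongr
      linarith
    · refine lt_of_pow_lt_pow_left₀ 2 (by positivity) ?_
      rw [mul_pow, mul_pow, ← e4, ← e4]
      have : (b j : ℝ) * δ ^ 2 < 4 * 4 ^ m * δ ^ 2 := by gcongr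
      linarith
  have hsing := Finset.single_le_sum hnn hmem
  rw [if_pos ⟨by simp [levelSet, hai, hl], by simp [levelSet, hbj, hm]⟩] at hsing
  linarith

theorem sum_scaleCost_snd_le {n : ℕ} {δ : ℝ} (hδ : 1 ≤ δ) {s : ℕ → ℝ} (hs : ∀ l, 0 ≤ s l)
    (hsum : ∑ l ∈ dyadicLevels n, 16 ^ l * s l ≤ 16 * n) :
    ∑ p ∈ heavyScales n δ, 4 ^ p.1 * 4 ^ p.2 * (scaleCost n p.2 (s p.2) / heavyRate δ p.1 p.2) ≤
      1056 * (n * δ ^ 2) := by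
  refine le_trans (le_of_eq ?_) (sum_scaleCost_le hδ hs hsum)
  rw [← sum_heavyScales_swap n δ fun l m => 4 ^ l * 4 ^ m * (scaleCost n l (s l) / heavyRate δ l m)]
  refine Finset.sum_congr rfl fun p _ => ?_
  rw [heavyRate_comm, mul_comm ((4 : ℝ) ^ p.1)]

theorem sum_heavyScales_levelSet {n : ℕ} (A : Matrix (Fin n) (Fin n) ℝ) (a b : Fin n → ℕ)
    (δ : ℝ) :
    ∑ i, ∑ j, A i j * ∑ p ∈ heavyScales n δ,
        (if i ∈ levelSet a p.1 ∧ j ∈ levelSet b p.2 then 16 * ((4 : ℝ) ^ p.1 * 4 ^ p.2) else 0) =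
      ∑ p ∈ heavyScales n δ, 16 * ((4 : ℝ) ^ p.1 * 4 ^ p.2) *
        ∑ i ∈ levelSet a p.1, ∑ j ∈ levelSet b p.2, A i j := by
  classical
  simp only [Finset.mul_sum]
  rw [Finset.sum_congr rfl fun i _ => Finset.sum_comm, Finset.sum_comm]
  refine Finset.sum_congr rfl fun p _ => ?_
  rw [← Finset.sum_subset (Finset.subset_univ (levelSet a p.1)) fun i _ hi =>
    Finset.sum_eq_zero fun j _ => by simp [hi]]
  refine Finset.sum_congr rfl fun i hi => ?_
  rw [← Finset.sum_subset (Finset.subset_univ (levelSet b p.2)) fun j _ hj => by simp [hj]]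
  exact Finset.sum_congr rfl fun j hj => by rw [if_pos ⟨hi, hj⟩, mul_comm]

/-- Divide the discrepancy bound by the rate, using its lower bound `1 / 2` for the mean term and
for the error `X`. The costs keep their division by the rate, which their summation needs. -/
theorem mul_discrepancy_le {n : ℕ} {δ ρ e x y X : ℝ} (hδ : 1 ≤ δ) (hρ : 0 ≤ ρ) {l m : ℕ}
    (hp : (l, m) ∈ heavyScales n δ) (hx : 0 ≤ x) (hy : 0 ≤ y) (hX : 0 ≤ X)
    (hd : heavyRate δ l m * e ≤ ρ * (x * y) * Real.exp (2 * heavyRate δ l m) + scaleCost n l x +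
      scaleCost n m y + X) :
    16 * (4 ^ l * 4 ^ m) * e ≤ 1536 * ρ / δ ^ 2 * ((16 ^ l * x) * (16 ^ m * y)) +
      16 * (4 ^ l * 4 ^ m * (scaleCost n l x / heavyRate δ l m)) +
      16 * (4 ^ l * 4 ^ m * (scaleCost n m y / heavyRate δ l m)) +
      32 * (4 ^ l * 4 ^ m * X) := by
  have ht := half_le_heavyRate hδ hp
  have he := exp_two_mul_heavyRate_le hδ l m
  set t := heavyRate δ l m
  set w : ℝ := 4 ^ l * 4 ^ m
  have hw : 0 < w := by positivity
  have ht0 : 0 < t := by linarith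
  have hti : t⁻¹ ≤ 2 := by rw [inv_le_comm₀ ht0 two_pos]; linarith
  have hww : w * w = 16 ^ l * 16 ^ m := by
    simp only [w]
    rw [mul_mul_mul_comm, ← mul_pow, ← mul_pow]
    norm_num
  rw [mul_comm, ← le_div_iff₀ ht0] at hd
  calc 16 * w * _ ≤ 16 * w * ((ρ * (x * y) * Real.exp (2 * t) + scaleCost n l x +
        scaleCost n m y + X) / t) := by gcongr
    _ = 16 * w * (ρ * (x * y) * Real.exp (2 * t)) * t⁻¹ + 16 * (w * (scaleCost n l x / t)) +
        16 * (w * (scaleCost n m y / t)) + 16 * (w * X) * t⁻¹ := by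
        rw [div_eq_mul_inv, div_eq_mul_inv, div_eq_mul_inv]; ring
    _ ≤ 16 * w * (ρ * (x * y) * (48 * w / δ ^ 2)) * 2 + 16 * (w * (scaleCost n l x / t)) +
        16 * (w * (scaleCost n m y / t)) + 16 * (w * X) * 2 := by gcongr
    _ = 1536 * ρ / δ ^ 2 * (x * y) * (w * w) + 16 * (w * (scaleCost n l x / t)) +
        16 * (w * (scaleCost n m y / t)) + 32 * (w * X) := by ring
    _ = _ := by rw [hww]; ring

theorem sum_heavyScales_card_le {n : ℕ} {a b : Fin n → ℕ} (ha : ∑ i, a i ^ 2 ≤ 16 * n)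
    (hb : ∑ i, b i ^ 2 ≤ 16 * n) (δ : ℝ) :
    ∑ p ∈ heavyScales n δ,
      ((16 : ℝ) ^ p.1 * (levelSet a p.1).card) * (16 ^ p.2 * (levelSet b p.2).card) ≤
        (16 * n) * (16 * n) := by
  have hSa := sum_card_levelSet_le ha
  have hSb := sum_card_levelSet_le hb
  calc _ ≤ ∑ p ∈ dyadicLevels n ×ˢ dyadicLevels n,
        ((16 : ℝ) ^ p.1 * (levelSet a p.1).card) * (16 ^ p.2 * (levelSet b p.2).card) := by
        refine Finset.sum_le_sum_of_subset_of_nonneg (Finset.filter_subset _ _) fun p _ _ => ?_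
        positivity
    _ = (∑ l ∈ dyadicLevels n, (16 : ℝ) ^ l * (levelSet a l).card) *
        ∑ m ∈ dyadicLevels n, (16 : ℝ) ^ m * (levelSet b m).card := by
        rw [Finset.sum_mul_sum, ← Finset.sum_product']
    _ ≤ _ := by gcongr

/-- The heavy part of the bilinear form of a nonnegative matrix with bounded row and column sums
and controlled discrepancy. -/
theorem sum_heavy_le {n : ℕ} {A : Matrix (Fin n) (Fin n) ℝ} (hA : ∀ i j, 0 ≤ A i j)
    {a b : Fin n → ℕ} (ha : ∑ i, a i ^ 2 ≤ 16 * n) (hb : ∑ i, b i ^ 2 ≤ 16 * n) {δ ρ D : ℝ}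
    (hδ : 1 ≤ δ) (hρ : 0 ≤ ρ) (hδρ : δ ^ 4 = n * ρ)
    (hrow : ∀ i, a i ≠ 0 → ∑ j, A i j ≤ D * δ ^ 4) (hcol : ∀ j, b j ≠ 0 → ∑ i, A i j ≤ D * δ ^ 4)
    (hD : 0 ≤ D) {X : ℕ → ℕ → ℝ} (hX : ∀ l m, 0 ≤ X l m)
    (hdisc : ∀ l m, (l, m) ∈ heavyScales n δ → ∀ I J : Finset (Fin n),
      heavyRate δ l m * ∑ i ∈ I, ∑ j ∈ J, A i j ≤
        ρ * (I.card * J.card) * Real.exp (2 * heavyRate δ l m) + scaleCost n l I.card +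
          scaleCost n m J.card + X l m) :
    ∑ i, ∑ j, A i j * (if δ ^ 2 < (a i : ℝ) * b j then (a i : ℝ) * b j else 0) ≤
      (427008 + 32 * D) * (n * δ ^ 2) + 32 * ∑ p ∈ heavyScales n δ, 4 ^ p.1 * 4 ^ p.2 * X p.1 p.2 := by
  have hδ0 : 0 < δ := by linarith
  have ha' : ∑ i, (a i : ℝ) ^ 2 ≤ 16 * n := by exact_mod_cast ha
  have hb' : ∑ i, (b i : ℝ) ^ 2 ≤ 16 * n := by exact_mod_cast hb
  have hrows : ∀ (c : Fin n → ℕ) (r : Fin n → ℝ), ∑ i, (c i : ℝ) ^ 2 ≤ 16 * n →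
      (∀ i, c i ≠ 0 → r i ≤ D * δ ^ 4) → ∑ i, (c i : ℝ) ^ 2 / δ ^ 2 * r i ≤ 16 * D * (n * δ ^ 2) := by
    intro c r hc hr
    calc ∑ i, (c i : ℝ) ^ 2 / δ ^ 2 * r i ≤ ∑ i, (c i : ℝ) ^ 2 * (D * δ ^ 2) := by
          refine Finset.sum_le_sum fun i _ => ?_
          by_cases h0 : c i = 0
          · simp [h0]
          calc (c i : ℝ) ^ 2 / δ ^ 2 * r i ≤ (c i : ℝ) ^ 2 / δ ^ 2 * (D * δ ^ 4) := by
                gcongr; exact hr i h0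
            _ = _ := by field_simp
      _ = (∑ i, (c i : ℝ) ^ 2) * (D * δ ^ 2) := by rw [Finset.sum_mul]
      _ ≤ 16 * n * (D * δ ^ 2) := by gcongr
      _ = _ := by ring
  have h1 : ∑ i, ∑ j, A i j * ((a i : ℝ) ^ 2 / δ ^ 2) ≤ 16 * D * (n * δ ^ 2) := by
    refine le_trans (le_of_eq ?_) (hrows a (fun i => ∑ j, A i j) ha' hrow)
    refine Finset.sum_congr rfl fun i _ => ?_
    rw [Finset.mul_sum]
    exact Finset.sum_congr rfl fun j _ => mul_comm _ _
  have h2 : ∑ i, ∑ j, A i j * ((b j : ℝ) ^ 2 / δ ^ 2) ≤ 16 * D * (n * δ ^ 2) := by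
    refine le_trans (le_of_eq ?_) (hrows b (fun j => ∑ i, A i j) hb' hcol)
    rw [Finset.sum_comm]
    refine Finset.sum_congr rfl fun i _ => ?_
    rw [Finset.mul_sum]
    exact Finset.sum_congr rfl fun j _ => mul_comm _ _
  have h4 : ∑ p ∈ heavyScales n δ, 16 * ((4 : ℝ) ^ p.1 * 4 ^ p.2) *
        ∑ i ∈ levelSet a p.1, ∑ j ∈ levelSet b p.2, A i j ≤ ∑ p ∈ heavyScales n δ,
      (1536 * ρ / δ ^ 2 * ((16 ^ p.1 * (levelSet a p.1).card) * (16 ^ p.2 * (levelSet b p.2).card)) +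
      16 * (4 ^ p.1 * 4 ^ p.2 * (scaleCost n p.1 (levelSet a p.1).card / heavyRate δ p.1 p.2)) +
      16 * (4 ^ p.1 * 4 ^ p.2 * (scaleCost n p.2 (levelSet b p.2).card / heavyRate δ p.1 p.2)) +
      32 * (4 ^ p.1 * 4 ^ p.2 * X p.1 p.2)) :=
    Finset.sum_le_sum fun p hp => mul_discrepancy_le hδ hρ hp (Nat.cast_nonneg _)
      (Nat.cast_nonneg _) (hX _ _) (hdisc p.1 p.2 hp _ _)
  rw [Finset.sum_add_distrib, Finset.sum_add_distrib, Finset.sum_add_distrib, ← Finset.mul_sum,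
    ← Finset.mul_sum, ← Finset.mul_sum, ← Finset.mul_sum] at h4
  have h5 := sum_heavyScales_card_le ha hb δ
  have h6 := sum_scaleCost_le hδ (fun l => Nat.cast_nonneg (levelSet a l).card)
    (sum_card_levelSet_le ha)
  have h7 := sum_scaleCost_snd_le hδ (fun l => Nat.cast_nonneg (levelSet b l).card)
    (sum_card_levelSet_le hb)
  -- `ρ n² / δ² = n δ²`. The final constant is `427008 = 393216 + 2 · 16 · 1056`.
  have h8 : 1536 * ρ / δ ^ 2 * ((16 * n) * (16 * n)) = 393216 * (n * δ ^ 2) := by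
    rw [div_mul_eq_mul_div, div_eq_iff (by positivity)]
    linear_combination (-393216 * n : ℝ) * hδρ
  have h9 := mul_le_mul_of_nonneg_left h5 (show 0 ≤ 1536 * ρ / δ ^ 2 by positivity)
  have h10 : ∑ i, ∑ j, A i j * (if δ ^ 2 < (a i : ℝ) * b j then (a i : ℝ) * b j else 0) ≤
      ∑ i, ∑ j, A i j * ((a i : ℝ) ^ 2 / δ ^ 2 + (b j : ℝ) ^ 2 / δ ^ 2 + ∑ p ∈ heavyScales n δ,
        if i ∈ levelSet a p.1 ∧ j ∈ levelSet b p.2 then 16 * ((4 : ℝ) ^ p.1 * 4 ^ p.2) else 0) :=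
    Finset.sum_le_sum fun i _ => Finset.sum_le_sum fun j _ =>
      mul_le_mul_of_nonneg_left (heavy_entry_le ha hb hδ i j) (hA i j)
  have h11 : ∀ u v w : Fin n → Fin n → ℝ, ∑ i, ∑ j, A i j * (u i j + v i j + w i j) =
      ∑ i, ∑ j, A i j * u i j + ∑ i, ∑ j, A i j * v i j + ∑ i, ∑ j, A i j * w i j := fun u v w => by
    simp only [mul_add, Finset.sum_add_distrib]
  rw [h11, sum_heavyScales_levelSet] at h10
  linarith

/-! ### Random moments and their expectations -/

/-- The coefficients of the light part of the bilinear form, scaled to be at most `1 / 2`. -/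
noncomputable def lightWeight {n : ℕ} (δ : ℝ) (f g : Fin n → ℤ) (i j : Fin n) : ℝ :=
  if |(f i : ℝ) * g j| ≤ δ ^ 2 then (f i : ℝ) * g j / (2 * δ ^ 2) else 0

/-- The exponential moment controlling the light parts over the whole net. -/
noncomputable def lightMoment {n : ℕ} (δ : ℝ) (M A : Matrix (Fin n) (Fin n) ℝ) : ℝ :=
  ∑ f ∈ latticeBall n, ∑ g ∈ latticeBall n,
    Real.exp (∑ i, ∑ j, (A i j - M i j) * lightWeight δ f g i j - 164 * n)

/-- The exponential moment controlling the discrepancy at a pair of scales. -/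
noncomputable def discrepancyMoment {n : ℕ} (δ ρ : ℝ) (l m : ℕ) (A : Matrix (Fin n) (Fin n) ℝ) :
    ℝ :=
  ∑ I : Finset (Fin n), ∑ J : Finset (Fin n),
    Real.exp (heavyRate δ l m * ∑ i ∈ I, ∑ j ∈ J, A i j -
      (ρ * (I.card * J.card) * Real.exp (2 * heavyRate δ l m) + scaleCost n l I.card +
        scaleCost n m J.card))

/-- The exponential moment controlling the number of nodes of degree larger than `τ`. -/
noncomputable def degreeMoment {n : ℕ} (τ : ℝ) (A : Matrix (Fin n) (Fin n) ℝ) : ℝ :=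
  ∑ i, Real.exp (nodeDegree A i - τ)

/-- After squaring, the deviation is bounded linearly in `Z`, so a bound on the mean of `Z` is
enough. -/
theorem le_sqrt_of_exp_le {a Z : ℝ} (h : Real.exp a ≤ Z) : a ≤ √Z := by
  refine le_trans ?_ (Real.sqrt_le_sqrt h)
  rw [Real.sqrt_eq_rpow, ← Real.exp_mul]
  have h1 := Real.add_one_le_exp (a * (1 / 2) - 1)
  have h2 : Real.exp (a * (1 / 2)) = Real.exp (a * (1 / 2) - 1) * Real.exp 1 := by
    rw [← Real.exp_add]; ring_nf
  have h3 : 2 ≤ Real.exp 1 := by linarith [Real.add_one_le_exp (1 : ℝ)]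
  have h4 := Real.exp_pos (a * (1 / 2) - 1)
  rw [h2]
  nlinarith

theorem sum_sq_mul_sq_le {n : ℕ} {f g : Fin n → ℤ} (hf : f ∈ latticeBall n)
    (hg : g ∈ latticeBall n) : ∑ i, ∑ j, ((f i : ℝ) * g j) ^ 2 ≤ 256 * n ^ 2 := by
  have hf' : ∑ i, (f i : ℝ) ^ 2 ≤ 16 * n := by exact_mod_cast mem_latticeBall.1 hf
  have hg' : ∑ i, (g i : ℝ) ^ 2 ≤ 16 * n := by exact_mod_cast mem_latticeBall.1 hg
  simp only [mul_pow]
  rw [← Finset.sum_mul_sum]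
  have h0 : 0 ≤ ∑ i, (g i : ℝ) ^ 2 := Finset.sum_nonneg fun _ _ => sq_nonneg _
  calc _ ≤ (16 * n : ℝ) * (16 * n) := by gcongr
    _ = _ := by ring

section Moments

variable {Ω : Type*} [MeasurableSpace Ω] {μ : Measure Ω} [IsProbabilityMeasure μ] {n : ℕ}
  {M : Matrix (Fin n) (Fin n) ℝ} {A : Ω → Matrix (Fin n) (Fin n) ℝ} {δ ρ : ℝ}

theorem IsRandomAdjacency.integral_exp_light_le (h : IsRandomAdjacency μ M A)
    (hM : ∀ i j, M i j ∈ Set.Icc 0 ρ) (hsymm : ∀ i j, M i j = M j i) (hdiag : ∀ i, M i i = 0)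
    (hδ : 1 ≤ δ) (hδρ : δ ^ 4 = n * ρ) {f g : Fin n → ℤ} (hf : f ∈ latticeBall n)
    (hg : g ∈ latticeBall n) :
    ∫ ω, Real.exp (∑ i, ∑ j, (A ω i j - M i j) * lightWeight δ f g i j) ∂μ ≤
      Real.exp (128 * n) := by
  have hδ0 : 0 < δ := by linarith
  set c := lightWeight δ f g with hc
  have hsplit : ∀ ω, Real.exp (∑ i, ∑ j, (A ω i j - M i j) * c i j) =
      Real.exp (-∑ i, ∑ j, M i j * c i j) * Real.exp (∑ i, ∑ j, A ω i j * c i j) := by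
    intro ω
    rw [← Real.exp_add]
    simp only [sub_mul, Finset.sum_sub_distrib]
    ring_nf
  simp only [hsplit]
  rw [integral_const_mul]
  refine (mul_le_mul_of_nonneg_left (h.integral_exp_le (fun i j => (hM i j).1) hsymm hdiag c)
    (Real.exp_pos _).le).trans ?_
  rw [← Real.exp_add, Real.exp_le_exp]
  have hpt : ∀ i j, 2⁻¹ * (M i j * (Real.exp (2 * c i j) - 1)) - M i j * c i j ≤
      ρ / (2 * δ ^ 4) * ((f i : ℝ) * g j) ^ 2 := by
    intro i j
    -- The doubling comes from the exponential-moment bound; the range of `lightWeight` makes the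
    -- quadratic estimate `|exp x - 1 - x| ≤ x²` available.
    have hcle : |2 * c i j| ≤ 1 := by
      rw [hc, lightWeight]
      split_ifs with h1
      · rw [abs_mul, abs_div, abs_of_pos (show (0 : ℝ) < 2 * δ ^ 2 by positivity),
          abs_of_pos (two_pos : (0 : ℝ) < 2), ← mul_div_assoc, div_le_one (by positivity)]
        linarith
      · simp
    have hcsq : c i j ^ 2 ≤ ((f i : ℝ) * g j) ^ 2 / (4 * δ ^ 4) := by
      rw [hc, lightWeight]
      split_ifs with h1
      · rw [div_pow]
        exact le_of_eq (by ring)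
      · rw [zero_pow two_ne_zero]; positivity
    have h2 := (le_abs_self _).trans (Real.abs_exp_sub_one_sub_id_le hcle)
    calc 2⁻¹ * (M i j * (Real.exp (2 * c i j) - 1)) - M i j * c i j
        = M i j * (2⁻¹ * (Real.exp (2 * c i j) - 1 - 2 * c i j)) := by ring
      _ ≤ M i j * (2⁻¹ * (2 * c i j) ^ 2) := by
          have := (hM i j).1
          gcongr
      _ = M i j * (2 * c i j ^ 2) := by ring
      _ ≤ ρ * (2 * (((f i : ℝ) * g j) ^ 2 / (4 * δ ^ 4))) := by
          have := (hM i j).1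
          have := (hM i j).2
          have : 0 ≤ ρ := by linarith
          gcongr
      _ = _ := by ring
  calc -∑ i, ∑ j, M i j * c i j + 2⁻¹ * ∑ i, ∑ j, M i j * (Real.exp (2 * c i j) - 1)
      = ∑ i, ∑ j, (2⁻¹ * (M i j * (Real.exp (2 * c i j) - 1)) - M i j * c i j) := by
        simp only [Finset.sum_sub_distrib, Finset.mul_sum]; ring
    _ ≤ ∑ i, ∑ j, ρ / (2 * δ ^ 4) * ((f i : ℝ) * g j) ^ 2 :=
        Finset.sum_le_sum fun i _ => Finset.sum_le_sum fun j _ => hpt i j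
    _ = ρ / (2 * δ ^ 4) * ∑ i, ∑ j, ((f i : ℝ) * g j) ^ 2 := by simp only [Finset.mul_sum]
    _ ≤ ρ / (2 * δ ^ 4) * (256 * n ^ 2) := by
        rcases n.eq_zero_or_pos with rfl | hn
        · simp
        have hρ : 0 ≤ ρ := ((hM ⟨0, hn⟩ ⟨0, hn⟩).1).trans (hM ⟨0, hn⟩ ⟨0, hn⟩).2
        have := sum_sq_mul_sq_le hf hg
        gcongr
    _ = 128 * n := by
        rw [div_mul_eq_mul_div, div_eq_iff (by positivity)]
        linear_combination (-256 * n : ℝ) * hδρ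

theorem IsRandomAdjacency.integral_lightMoment_le (h : IsRandomAdjacency μ M A)
    (hM : ∀ i j, M i j ∈ Set.Icc 0 ρ) (hsymm : ∀ i j, M i j = M j i) (hdiag : ∀ i, M i i = 0)
    (hδ : 1 ≤ δ) (hδρ : δ ^ 4 = n * ρ) : ∫ ω, lightMoment δ M (A ω) ∂μ ≤ 1 := by
  unfold lightMoment
  rw [integral_finsetSum _ fun f _ => h.integrable_comp fun B => ∑ g ∈ latticeBall n,
    Real.exp (∑ i, ∑ j, (B i j - M i j) * lightWeight δ f g i j - 164 * n)]
  have hpt : ∀ f ∈ latticeBall n, ∫ ω, ∑ g ∈ latticeBall n,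
      Real.exp (∑ i, ∑ j, (A ω i j - M i j) * lightWeight δ f g i j - 164 * n) ∂μ ≤
        ∑ _g ∈ latticeBall n, Real.exp (-(36 * n)) := by
    intro f hf
    rw [integral_finsetSum _ fun g _ => h.integrable_comp fun B =>
      Real.exp (∑ i, ∑ j, (B i j - M i j) * lightWeight δ f g i j - 164 * n)]
    -- `164 = 128 + 36`: the moment bound is `exp (128 n)`, and the pairs of net points number at
    -- most `exp (36 n)`.
    refine Finset.sum_le_sum fun g hg => ?_
    simp only [Real.exp_sub]
    rw [integral_div, div_le_iff₀ (Real.exp_pos _), ← Real.exp_add]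
    refine (h.integral_exp_light_le hM hsymm hdiag hδ hδρ hf hg).trans_eq ?_
    ring_nf
  refine (Finset.sum_le_sum hpt).trans ?_
  rw [Finset.sum_const, Finset.sum_const, smul_smul, nsmul_eq_mul]
  push_cast
  have hcard := card_latticeBall_le n
  calc ((latticeBall n).card : ℝ) * (latticeBall n).card * Real.exp (-(36 * n))
      ≤ Real.exp (18 * n) * Real.exp (18 * n) * Real.exp (-(36 * n)) := by gcongr
    _ = 1 := by rw [← Real.exp_add, ← Real.exp_add, Real.exp_eq_one_iff]; ring

/-- By the binomial theorem, the subsets weighted by `exp (-4l |I|)` sum to `(1 + exp (-4l))^n ≤ exp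
(n exp (-4l))`. The second term of the cost cancels exactly this, with no need to fix the size of
the set. -/
theorem sum_exp_neg_scaleCost_le (n l : ℕ) :
    ∑ I : Finset (Fin n), Real.exp (-scaleCost n l I.card) ≤ 1 := by
  have h1 : ∀ I : Finset (Fin n), Real.exp (-scaleCost n l I.card) =
      Real.exp (-(n * Real.exp (-(4 * l)))) *
        (Real.exp (-(4 * l)) ^ I.card * 1 ^ (Fintype.card (Fin n) - I.card)) := by
    intro I
    rw [one_pow, mul_one, ← Real.exp_nat_mul, ← Real.exp_add, scaleCost]
    ring_nf
  simp only [h1]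
  rw [← Finset.mul_sum, Fintype.sum_pow_mul_eq_add_pow, Fintype.card_fin]
  calc Real.exp (-(n * Real.exp (-(4 * l)))) * (Real.exp (-(4 * l)) + 1) ^ n
      ≤ Real.exp (-(n * Real.exp (-(4 * l)))) * Real.exp (Real.exp (-(4 * l))) ^ n := by
        gcongr
        exact Real.add_one_le_exp _
    _ = 1 := by
        rw [← Real.exp_nat_mul, ← Real.exp_add, neg_add_cancel, Real.exp_zero]

theorem sum_mem_sum_mem_eq {n : ℕ} (B : Fin n → Fin n → ℝ) (c : ℝ) (I J : Finset (Fin n)) :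
    ∑ i, ∑ j, B i j * (if i ∈ I ∧ j ∈ J then c else 0) = c * ∑ i ∈ I, ∑ j ∈ J, B i j := by
  rw [← Finset.sum_subset (Finset.subset_univ I) fun i _ hi =>
    Finset.sum_eq_zero fun j _ => by simp [hi], Finset.mul_sum]
  refine Finset.sum_congr rfl fun i hi => ?_
  rw [← Finset.sum_subset (Finset.subset_univ J) fun j _ hj => by simp [hj], Finset.mul_sum]
  exact Finset.sum_congr rfl fun j hj => by rw [if_pos ⟨hi, hj⟩, mul_comm]

/-- `I` and `J` may overlap, so an edge can be counted twice; hence the exponent `2t`. -/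
theorem IsRandomAdjacency.integral_exp_sum_le (h : IsRandomAdjacency μ M A)
    (hM : ∀ i j, M i j ∈ Set.Icc 0 ρ) (hsymm : ∀ i j, M i j = M j i) (hdiag : ∀ i, M i i = 0)
    {t : ℝ} (ht : 0 ≤ t) (I J : Finset (Fin n)) :
    ∫ ω, Real.exp (t * ∑ i ∈ I, ∑ j ∈ J, A ω i j) ∂μ ≤
      Real.exp (2⁻¹ * (ρ * (I.card * J.card) * (Real.exp (2 * t) - 1))) := by
  have h1 := h.integral_exp_le (fun i j => (hM i j).1) hsymm hdiag
    fun i j => if i ∈ I ∧ j ∈ J then t else 0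
  have h2 : ∀ i j, Real.exp (2 * if i ∈ I ∧ j ∈ J then t else 0) - 1 =
      if i ∈ I ∧ j ∈ J then Real.exp (2 * t) - 1 else 0 := by
    intro i j
    split_ifs <;> simp
  simp only [h2] at h1
  simp_rw [fun ω => sum_mem_sum_mem_eq (A ω) t I J, sum_mem_sum_mem_eq M] at h1
  refine h1.trans (Real.exp_le_exp.2 ?_)
  have h3 : 0 ≤ Real.exp (2 * t) - 1 := by linarith [Real.one_le_exp (show 0 ≤ 2 * t by linarith)]
  rw [mul_comm (ρ * _)]
  gcongr
  calc ∑ i ∈ I, ∑ j ∈ J, M i j ≤ ∑ _i ∈ I, ∑ _j ∈ J, ρ :=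
        Finset.sum_le_sum fun i _ => Finset.sum_le_sum fun j _ => (hM i j).2
    _ = ρ * (I.card * J.card) := by simp; ring

theorem IsRandomAdjacency.integral_discrepancyMoment_le (h : IsRandomAdjacency μ M A)
    (hM : ∀ i j, M i j ∈ Set.Icc 0 ρ) (hsymm : ∀ i j, M i j = M j i) (hdiag : ∀ i, M i i = 0)
    (hδ : 1 ≤ δ) (hρ : 0 ≤ ρ) {l m : ℕ} (hlm : (l, m) ∈ heavyScales n δ) :
    ∫ ω, discrepancyMoment δ ρ l m (A ω) ∂μ ≤ 1 := by
  unfold discrepancyMoment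
  have ht : 0 ≤ heavyRate δ l m := by linarith [half_le_heavyRate hδ hlm]
  set t := heavyRate δ l m
  rw [integral_finsetSum _ fun I _ => h.integrable_comp fun B => ∑ J : Finset (Fin n),
    Real.exp (t * ∑ i ∈ I, ∑ j ∈ J, B i j - (ρ * (I.card * J.card) * Real.exp (2 * t) +
      scaleCost n l I.card + scaleCost n m J.card))]
  calc _ ≤ ∑ I : Finset (Fin n), ∑ J : Finset (Fin n),
        Real.exp (-scaleCost n l I.card) * Real.exp (-scaleCost n m J.card) := by
        refine Finset.sum_le_sum fun I _ => ?_
        rw [integral_finsetSum _ fun J _ => h.integrable_comp fun B =>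
          Real.exp (t * ∑ i ∈ I, ∑ j ∈ J, B i j - (ρ * (I.card * J.card) * Real.exp (2 * t) +
            scaleCost n l I.card + scaleCost n m J.card))]
        refine Finset.sum_le_sum fun J _ => ?_
        simp only [Real.exp_sub]
        rw [integral_div, div_le_iff₀ (Real.exp_pos _), ← Real.exp_add, ← Real.exp_add]
        refine (h.integral_exp_sum_le hM hsymm hdiag ht I J).trans (Real.exp_le_exp.2 ?_)
        have h1 : 0 ≤ ρ * (I.card * J.card) := by positivity
        have h2 := Real.exp_pos (2 * t)
        nlinarith [mul_nonneg h1 h2.le]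
    _ = (∑ I : Finset (Fin n), Real.exp (-scaleCost n l I.card)) *
          ∑ J : Finset (Fin n), Real.exp (-scaleCost n m J.card) := by
        rw [Finset.sum_mul_sum]
    _ ≤ 1 * 1 := by
        gcongr
        · exact sum_exp_neg_scaleCost_le n l
        · exact sum_exp_neg_scaleCost_le n m
    _ = 1 := one_mul 1

theorem IsRandomAdjacency.integral_degreeMoment_le (h : IsRandomAdjacency μ M A)
    (hM : ∀ i j, M i j ∈ Set.Icc 0 ρ) (hsymm : ∀ i j, M i j = M j i) (hdiag : ∀ i, M i i = 0)
    (hδ : 1 ≤ δ) (hδρ : δ ^ 4 = n * ρ) {D : ℝ} (hD : 5 ≤ D) :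
    ∫ ω, degreeMoment (D * δ ^ 4) (A ω) ∂μ ≤ n / δ ^ 4 := by
  have hδ0 : 0 < δ := by linarith
  have hd : 0 < δ ^ 4 := by positivity
  unfold degreeMoment
  rw [integral_finsetSum _ fun i _ => h.integrable_comp fun B =>
    Real.exp (nodeDegree B i - D * δ ^ 4)]
  calc _ ≤ ∑ _i : Fin n, (δ ^ 4)⁻¹ := by
        refine Finset.sum_le_sum fun i _ => ?_
        simp only [Real.exp_sub]
        rw [integral_div, div_le_iff₀ (Real.exp_pos _)]
        -- A degree is the edge sum with `I = {i}` and `J` everything. As `(e² - 1) / 2 ≤ 4`, its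
        -- exponential moment is at most `exp (4 δ⁴)`; the fifth `δ⁴` in the threshold pays for the
        -- factor `1 / δ⁴`.
        have h1 := h.integral_exp_sum_le hM hsymm hdiag (zero_le_one' ℝ) {i} Finset.univ
        simp only [Finset.sum_singleton, one_mul, mul_one, Finset.card_singleton, Nat.cast_one,
          Finset.card_univ, Fintype.card_fin] at h1
        rw [mul_comm ρ, ← hδρ] at h1
        refine h1.trans ?_
        have he : Real.exp 2 ≤ 9 := by
          have h2 : Real.exp 2 = Real.exp 1 * Real.exp 1 := by rw [← Real.exp_add]; norm_num
          nlinarith [Real.exp_one_lt_three, Real.exp_pos (1 : ℝ)]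
        have h3 : δ ^ 4 ≤ Real.exp (δ ^ 4) := by linarith [Real.add_one_le_exp (δ ^ 4)]
        rw [inv_mul_eq_div (δ ^ 4), le_div_iff₀ hd]
        calc Real.exp (2⁻¹ * (δ ^ 4 * (Real.exp 2 - 1))) * δ ^ 4
            ≤ Real.exp (4 * δ ^ 4) * Real.exp (δ ^ 4) :=
              mul_le_mul (Real.exp_le_exp.2 (by nlinarith)) h3 hd.le (Real.exp_pos _).le
          _ = Real.exp (5 * δ ^ 4) := by rw [← Real.exp_add]; ring_nf
          _ ≤ Real.exp (D * δ ^ 4) := by gcongr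
    _ = n / δ ^ 4 := by simp [div_eq_mul_inv]

end Moments

/-! ### Spectral norm of the truncated noise -/

/-- The deterministic part of the bound on the spectral norm of the truncated noise. -/
noncomputable def noiseConst (D : ℝ) : ℝ := 53449 + 4 * D

/-- A bound on the spectral norm of `T_τ(A) - M` with `τ = D δ ^ 4`. -/
noncomputable def noiseBound {n : ℕ} (D δ ρ : ℝ) (M A : Matrix (Fin n) (Fin n) ℝ) : ℝ :=
  δ ^ 2 * noiseConst D + δ ^ 2 * (√(lightMoment δ M A) / (4 * n)) +
    4 / n * ∑ p ∈ heavyScales n δ, 4 ^ p.1 * 4 ^ p.2 * √(discrepancyMoment δ ρ p.1 p.2 A) +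
    2 * (ρ * √(2 * n * degreeMoment (D * δ ^ 4) A))

section Deterministic

variable {n : ℕ} {M A : Matrix (Fin n) (Fin n) ℝ} {δ ρ D : ℝ}

/-- The vector `f` restricted to the nodes of degree at most `τ`. -/
noncomputable def trimVec (τ : ℝ) (A : Matrix (Fin n) (Fin n) ℝ) (f : Fin n → ℤ) (i : Fin n) : ℤ :=
  open Classical in if τ < nodeDegree A i then 0 else f i

theorem trimVec_mem (τ : ℝ) {f : Fin n → ℤ} (hf : f ∈ latticeBall n) :
    trimVec τ A f ∈ latticeBall n := by
  rw [mem_latticeBall] at hf ⊢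
  refine (Finset.sum_le_sum fun i _ => ?_).trans hf
  unfold trimVec
  split_ifs
  · simpa using sq_nonneg (f i)
  · exact le_rfl

theorem le_sqrt_lightMoment {f g : Fin n → ℤ} (hf : f ∈ latticeBall n) (hg : g ∈ latticeBall n) :
    ∑ i, ∑ j, (A i j - M i j) * lightWeight δ f g i j ≤ 164 * n + √(lightMoment δ M A) := by
  have h1 := le_sqrt_of_exp_le (Z := lightMoment δ M A)
    (a := ∑ i, ∑ j, (A i j - M i j) * lightWeight δ f g i j - 164 * n) <| by
    have h2 := Finset.single_le_sum (f := fun g => Real.exp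
      (∑ i, ∑ j, (A i j - M i j) * lightWeight δ f g i j - 164 * n))
      (fun _ _ => (Real.exp_pos _).le) hg
    have h3 := Finset.single_le_sum (f := fun f => ∑ g ∈ latticeBall n, Real.exp
      (∑ i, ∑ j, (A i j - M i j) * lightWeight δ f g i j - 164 * n))
      (fun _ _ => Finset.sum_nonneg fun _ _ => (Real.exp_pos _).le) hf
    exact h2.trans h3
  linarith

theorem le_sqrt_discrepancyMoment (l m : ℕ) (I J : Finset (Fin n)) :
    heavyRate δ l m * ∑ i ∈ I, ∑ j ∈ J, A i j ≤
      ρ * (I.card * J.card) * Real.exp (2 * heavyRate δ l m) + scaleCost n l I.card +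
        scaleCost n m J.card + √(discrepancyMoment δ ρ l m A) := by
  have h1 := le_sqrt_of_exp_le (Z := discrepancyMoment δ ρ l m A)
    (a := heavyRate δ l m * ∑ i ∈ I, ∑ j ∈ J, A i j -
      (ρ * (I.card * J.card) * Real.exp (2 * heavyRate δ l m) + scaleCost n l I.card +
        scaleCost n m J.card)) <| by
    have h2 := Finset.single_le_sum (f := fun J : Finset (Fin n) => Real.exp
      (heavyRate δ l m * ∑ i ∈ I, ∑ j ∈ J, A i j -
      (ρ * (I.card * J.card) * Real.exp (2 * heavyRate δ l m) + scaleCost n l I.card +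
        scaleCost n m J.card))) (fun _ _ => (Real.exp_pos _).le) (Finset.mem_univ J)
    have h3 := Finset.single_le_sum (f := fun I : Finset (Fin n) => ∑ J : Finset (Fin n), Real.exp
      (heavyRate δ l m * ∑ i ∈ I, ∑ j ∈ J, A i j -
      (ρ * (I.card * J.card) * Real.exp (2 * heavyRate δ l m) + scaleCost n l I.card +
        scaleCost n m J.card)))
      (fun _ _ => Finset.sum_nonneg fun _ _ => (Real.exp_pos _).le) (Finset.mem_univ I)
    exact h2.trans h3
  linarith

theorem degreeMoment_nonneg (τ : ℝ) (A : Matrix (Fin n) (Fin n) ℝ) : 0 ≤ degreeMoment τ A :=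
  Finset.sum_nonneg fun _ _ => (Real.exp_pos _).le

open Classical in
/-- The part of the signal lost by the degree truncation. -/
theorem sum_trimmed_le (hM : ∀ i j, M i j ∈ Set.Icc 0 ρ) (hρ : 0 ≤ ρ) (τ : ℝ)
    {f g : Fin n → ℤ} (hf : f ∈ latticeBall n) (hg : g ∈ latticeBall n) :
    -∑ i, ∑ j, (if τ < nodeDegree A i ∨ τ < nodeDegree A j then M i j else 0) * ((f i : ℝ) * g j) ≤
      16 * n * (ρ * √(2 * n * degreeMoment τ A)) := by
  set B : Matrix (Fin n) (Fin n) ℝ :=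
    fun i j => if τ < nodeDegree A i ∨ τ < nodeDegree A j then M i j else 0 with hB
  have h1 : (∑ p : Fin n × Fin n, B p.1 p.2 * ((f p.1 : ℝ) * g p.2)) ^ 2 ≤ _ :=
    Finset.sum_mul_sq_le_sq_mul_sq Finset.univ (fun p : Fin n × Fin n => B p.1 p.2)
      (fun p => (f p.1 : ℝ) * g p.2)
  simp only [Fintype.sum_prod_type] at h1
  have h2 := sum_sq_mul_sq_le hf hg
  have h3 : ∀ i j, B i j ^ 2 ≤
      ρ ^ 2 * (Real.exp (nodeDegree A i - τ) + Real.exp (nodeDegree A j - τ)) := by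
    intro i j
    have hi := Real.exp_pos (nodeDegree A i - τ)
    have hj := Real.exp_pos (nodeDegree A j - τ)
    simp only [hB]
    split_ifs with hc
    · have h4 : M i j ^ 2 ≤ ρ ^ 2 := pow_le_pow_left₀ (hM i j).1 (hM i j).2 2
      -- A removed node contributes at least 1 to `degreeMoment`, which replaces the count of
      -- removed nodes.
      have h5 : 1 ≤ Real.exp (nodeDegree A i - τ) + Real.exp (nodeDegree A j - τ) := by
        rcases hc with hc | hc
        · linarith [Real.one_le_exp (sub_nonneg.2 hc.le)]
        · linarith [Real.one_le_exp (sub_nonneg.2 hc.le)]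
      nlinarith [sq_nonneg ρ]
    · rw [zero_pow two_ne_zero]; positivity
  have h4 : ∑ i, ∑ j, B i j ^ 2 ≤ ρ ^ 2 * (2 * n * degreeMoment τ A) := by
    calc ∑ i, ∑ j, B i j ^ 2 ≤ ∑ i, ∑ j,
          ρ ^ 2 * (Real.exp (nodeDegree A i - τ) + Real.exp (nodeDegree A j - τ)) :=
          Finset.sum_le_sum fun i _ => Finset.sum_le_sum fun j _ => h3 i j
      _ = _ := by
          simp only [← Finset.mul_sum, Finset.sum_add_distrib, Finset.sum_const, Finset.card_univ,
            Fintype.card_fin, nsmul_eq_mul, degreeMoment]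
          ring
  have hN : 0 ≤ 2 * n * degreeMoment τ A :=
    mul_nonneg (by positivity) (degreeMoment_nonneg τ A)
  refine (neg_le_abs _).trans (abs_le_of_sq_le_sq ?_ (by positivity))
  refine h1.trans ?_
  rw [mul_pow, mul_pow ρ, Real.sq_sqrt hN]
  have h0 : 0 ≤ ∑ i, ∑ j, ((f i : ℝ) * g j) ^ 2 :=
    Finset.sum_nonneg fun _ _ => Finset.sum_nonneg fun _ _ => sq_nonneg _
  calc _ ≤ (ρ ^ 2 * (2 * n * degreeMoment τ A)) * (256 * n ^ 2) := by gcongr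
    _ = _ := by ring

/-- The signal on the heavy pairs. -/
theorem sum_signal_heavy_le (hM : ∀ i j, M i j ∈ Set.Icc 0 ρ) (hρ : 0 ≤ ρ) (hδ : 1 ≤ δ)
    (hδρ : δ ^ 4 = n * ρ) {f g : Fin n → ℤ} (hf : f ∈ latticeBall n) (hg : g ∈ latticeBall n) :
    ∑ i, ∑ j, M i j * (if δ ^ 2 < |(f i : ℝ) * g j| then |(f i : ℝ) * g j| else 0) ≤
      256 * (n * δ ^ 2) := by
  have hδ0 : 0 < δ := by linarith
  calc _ ≤ ∑ i, ∑ j, ρ / δ ^ 2 * ((f i : ℝ) * g j) ^ 2 := by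
        refine Finset.sum_le_sum fun i _ => Finset.sum_le_sum fun j _ => ?_
        have h1 : (if δ ^ 2 < |(f i : ℝ) * g j| then |(f i : ℝ) * g j| else 0) ≤
            ((f i : ℝ) * g j) ^ 2 / δ ^ 2 := by
          split_ifs with h
          · rw [le_div_iff₀ (by positivity), ← sq_abs ((f i : ℝ) * g j)]
            nlinarith [abs_nonneg ((f i : ℝ) * g j)]
          · positivity
        calc _ ≤ ρ * (((f i : ℝ) * g j) ^ 2 / δ ^ 2) := by
              refine mul_le_mul (hM i j).2 h1 ?_ hρ
              split_ifs <;> positivity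
          _ = _ := by ring
    _ = ρ / δ ^ 2 * ∑ i, ∑ j, ((f i : ℝ) * g j) ^ 2 := by simp only [Finset.mul_sum]
    _ ≤ ρ / δ ^ 2 * (256 * n ^ 2) := by
        have := sum_sq_mul_sq_le hf hg
        gcongr
    _ = 256 * (n * δ ^ 2) := by
        rw [div_mul_eq_mul_div, div_eq_iff (by positivity)]
        linear_combination (-256 * n : ℝ) * hδρ

/-- The edges of the truncated graph on the heavy pairs. -/
theorem sum_edges_heavy_le (hA : ∀ i j, A i j = 0 ∨ A i j = 1) (hAs : ∀ i j, A i j = A j i)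
    (hρ : 0 ≤ ρ) (hδ : 1 ≤ δ) (hδρ : δ ^ 4 = n * ρ) (hD : 0 ≤ D) {f g : Fin n → ℤ}
    (hf : f ∈ latticeBall n) (hg : g ∈ latticeBall n)
    (hf0 : ∀ i, D * δ ^ 4 < nodeDegree A i → f i = 0)
    (hg0 : ∀ i, D * δ ^ 4 < nodeDegree A i → g i = 0) :
    ∑ i, ∑ j, A i j * (if δ ^ 2 < |(f i : ℝ) * g j| then |(f i : ℝ) * g j| else 0) ≤
      (427008 + 32 * D) * (n * δ ^ 2) + 32 * ∑ p ∈ heavyScales n δ,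
        4 ^ p.1 * 4 ^ p.2 * √(discrepancyMoment δ ρ p.1 p.2 A) := by
  have hnat : ∀ {f : Fin n → ℤ}, f ∈ latticeBall n → ∑ i, (f i).natAbs ^ 2 ≤ 16 * n := by
    intro f hf
    have h1 := mem_latticeBall.1 hf
    zify
    simpa [sq_abs] using h1
  have hz : ∀ {f : Fin n → ℤ} {i}, (∀ i, D * δ ^ 4 < nodeDegree A i → f i = 0) →
      (f i).natAbs ≠ 0 → nodeDegree A i ≤ D * δ ^ 4 := by
    intro f i h0 hi
    by_contra! hc
    exact hi (by rw [h0 i hc]; rfl)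
  have key := sum_heavy_le (A := A) (fun i j => by rcases hA i j with h | h <;> simp [h])
    (hnat hf) (hnat hg) hδ hρ hδρ (D := D) (fun i hi => hz hf0 hi)
    (fun j hj => by simpa only [nodeDegree, hAs _ j] using hz hg0 hj) hD
    (X := fun l m => √(discrepancyMoment δ ρ l m A)) (fun _ _ => Real.sqrt_nonneg _)
    fun l m _ I J => le_sqrt_discrepancyMoment l m I J
  simpa only [Nat.cast_natAbs, Int.cast_abs, ← abs_mul] using key

theorem hasOpBound_noiseBound (hn : 0 < n) (hM : ∀ i j, M i j ∈ Set.Icc 0 ρ) (hρ : 0 ≤ ρ)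
    (hδ : 1 ≤ δ) (hδρ : δ ^ 4 = n * ρ) (hD : 0 ≤ D) (hA : ∀ i j, A i j = 0 ∨ A i j = 1)
    (hAs : ∀ i j, A i j = A j i) :
    HasOpBound (degreeTruncation (D * δ ^ 4) A - M) (noiseBound D δ ρ M A) := by
  classical
  have hδ0 : 0 < δ := by linarith
  have hn' : (0 : ℝ) < n := by exact_mod_cast hn
  set K : ℝ := 2 * δ ^ 2 * (164 * n + √(lightMoment δ M A)) +
    ((427008 + 32 * D) * (n * δ ^ 2) + 32 * ∑ p ∈ heavyScales n δ,
        4 ^ p.1 * 4 ^ p.2 * √(discrepancyMoment δ ρ p.1 p.2 A)) + 256 * (n * δ ^ 2) +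
    16 * n * (ρ * √(2 * n * degreeMoment (D * δ ^ 4) A)) with hK
  -- The constant `53449` collects `41` from the light part, `53376` from the heavy edges and `32`
  -- from the heavy signal.
  have hKn : K / (8 * n) = noiseBound D δ ρ M A := by
    rw [div_eq_iff (by positivity), noiseBound, noiseConst, hK]
    field_simp
    ring
  rw [← hKn]
  refine hasOpBound_of_latticeBall hn fun f hf g hg => ?_
  set F := trimVec (D * δ ^ 4) A f with hF
  set G := trimVec (D * δ ^ 4) A g with hG
  have hFm : F ∈ latticeBall n := trimVec_mem _ hf
  have hGm : G ∈ latticeBall n := trimVec_mem _ hg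
  have hF0 : ∀ i, D * δ ^ 4 < nodeDegree A i → F i = 0 := fun i hi => if_pos hi
  have hG0 : ∀ i, D * δ ^ 4 < nodeDegree A i → G i = 0 := fun i hi => if_pos hi
  have e1 : ∀ i j, (degreeTruncation (D * δ ^ 4) A - M) i j * ((f i : ℝ) * g j) ≤
      2 * δ ^ 2 * ((A i j - M i j) * lightWeight δ F G i j) +
      A i j * (if δ ^ 2 < |(F i : ℝ) * G j| then |(F i : ℝ) * G j| else 0) +
      M i j * (if δ ^ 2 < |(F i : ℝ) * G j| then |(F i : ℝ) * G j| else 0) -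
      (if D * δ ^ 4 < nodeDegree A i ∨ D * δ ^ 4 < nodeDegree A j then M i j else 0) *
        ((f i : ℝ) * g j) := by
    intro i j
    -- Trimming the vectors instead of the matrix removes the same entries of `A`, but also those of
    -- `M`; the last term restores them.
    have e2 : (degreeTruncation (D * δ ^ 4) A - M) i j * ((f i : ℝ) * g j) =
        (A i j - M i j) * ((F i : ℝ) * G j) -
        (if D * δ ^ 4 < nodeDegree A i ∨ D * δ ^ 4 < nodeDegree A j then M i j else 0) *
          ((f i : ℝ) * g j) := by
      rw [Matrix.sub_apply, degreeTruncation, hF, hG, trimVec, trimVec]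
      by_cases h1 : D * δ ^ 4 < nodeDegree A i <;> by_cases h2 : D * δ ^ 4 < nodeDegree A j <;>
        simp [h1, h2]
    rw [e2]
    refine sub_le_sub_right ?_ _
    have hA0 : 0 ≤ A i j := by rcases hA i j with h | h <;> simp [h]
    have hM0 := (hM i j).1
    -- Light pairs keep the centred difference, where cancellation is needed; on heavy pairs `A` and
    -- `M` are bounded separately in absolute value.
    by_cases hl : |(F i : ℝ) * G j| ≤ δ ^ 2
    · rw [if_neg hl.not_gt, lightWeight, if_pos hl]
      refine le_of_eq ?_
      field_simp
      ring
    · rw [if_pos (not_le.1 hl), lightWeight, if_neg hl]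
      have h3 := le_abs_self ((F i : ℝ) * G j)
      have h4 := neg_le_abs ((F i : ℝ) * G j)
      nlinarith [mul_le_mul_of_nonneg_left h3 hA0, mul_le_mul_of_nonneg_left h4 hM0]
  refine (Finset.sum_le_sum fun i _ => Finset.sum_le_sum fun j _ => e1 i j).trans ?_
  simp only [Finset.sum_add_distrib, Finset.sum_sub_distrib, ← Finset.mul_sum]
  have h1 := mul_le_mul_of_nonneg_left (le_sqrt_lightMoment (A := A) (M := M) (δ := δ) hFm hGm)
    (show 0 ≤ 2 * δ ^ 2 by positivity)
  have h2 := sum_edges_heavy_le hA hAs hρ hδ hδρ hD hFm hGm hF0 hG0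
  have h3 := sum_signal_heavy_le hM hρ hδ hδρ hFm hGm
  have h4 := sum_trimmed_le (A := A) hM hρ (D * δ ^ 4) hf hg
  linarith

theorem lightMoment_nonneg (δ : ℝ) (M A : Matrix (Fin n) (Fin n) ℝ) : 0 ≤ lightMoment δ M A :=
  Finset.sum_nonneg fun _ _ => Finset.sum_nonneg fun _ _ => (Real.exp_pos _).le

theorem discrepancyMoment_nonneg (δ ρ : ℝ) (l m : ℕ) (A : Matrix (Fin n) (Fin n) ℝ) :
    0 ≤ discrepancyMoment δ ρ l m A :=
  Finset.sum_nonneg fun _ _ => Finset.sum_nonneg fun _ _ => (Real.exp_pos _).le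

theorem sq_noiseBound_le (hn : 0 < n) (hδ : 1 ≤ δ) :
    noiseBound D δ ρ M A ^ 2 ≤ 4 * (δ ^ 4 * noiseConst D ^ 2 + δ ^ 4 * lightMoment δ M A +
      4096 * δ ^ 2 / n * ∑ p ∈ heavyScales n δ, 4 ^ p.1 * 4 ^ p.2 * discrepancyMoment δ ρ p.1 p.2 A +
      8 * (n * ρ ^ 2) * degreeMoment (D * δ ^ 4) A) := by
  have hδ0 : 0 < δ := by linarith
  have hn1 : (1 : ℝ) ≤ n := by exact_mod_cast hn
  have h1 : (δ ^ 2 * (√(lightMoment δ M A) / (4 * n))) ^ 2 ≤ δ ^ 4 * lightMoment δ M A := by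
    rw [mul_pow, div_pow, Real.sq_sqrt (lightMoment_nonneg δ M A), ← pow_mul]
    gcongr
    exact div_le_self (lightMoment_nonneg δ M A) (by nlinarith)
  have h2 : (4 / n * ∑ p ∈ heavyScales n δ,
      4 ^ p.1 * 4 ^ p.2 * √(discrepancyMoment δ ρ p.1 p.2 A)) ^ 2 ≤ 4096 * δ ^ 2 / n *
        ∑ p ∈ heavyScales n δ, 4 ^ p.1 * 4 ^ p.2 * discrepancyMoment δ ρ p.1 p.2 A := by
    have hS : 0 ≤ ∑ p ∈ heavyScales n δ,
        (4 : ℝ) ^ p.1 * 4 ^ p.2 * discrepancyMoment δ ρ p.1 p.2 A :=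
      Finset.sum_nonneg fun p _ => mul_nonneg (by positivity) (discrepancyMoment_nonneg _ _ _ _ _)
    -- Cauchy–Schwarz with weights `4^l 4^m`, whose total is at most `256 n δ²`, makes the bound
    -- linear in the moments.
    have h3 := Finset.sum_sq_le_sum_mul_sum_of_sq_le_mul (heavyScales n δ)
      (r := fun p => 4 ^ p.1 * 4 ^ p.2 * √(discrepancyMoment δ ρ p.1 p.2 A))
      (f := fun p => (4 : ℝ) ^ p.1 * 4 ^ p.2)
      (g := fun p => 4 ^ p.1 * 4 ^ p.2 * discrepancyMoment δ ρ p.1 p.2 A)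
      (fun p _ => by positivity)
      (fun p _ => mul_nonneg (by positivity) (discrepancyMoment_nonneg _ _ _ _ _))
      (fun p _ => le_of_eq (by rw [mul_pow, Real.sq_sqrt (discrepancyMoment_nonneg _ _ _ _ _)]; ring))
    rw [mul_pow]
    calc _ ≤ (4 / (n : ℝ)) ^ 2 * ((256 * (n * δ ^ 2)) * ∑ p ∈ heavyScales n δ,
          4 ^ p.1 * 4 ^ p.2 * discrepancyMoment δ ρ p.1 p.2 A) := by
          refine mul_le_mul_of_nonneg_left (h3.trans ?_) (by positivity)
          exact mul_le_mul_of_nonneg_right (sum_heavyScales_weight_le hδ) hS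
      _ = _ := by field_simp; ring
  have h3 : (2 * (ρ * √(2 * n * degreeMoment (D * δ ^ 4) A))) ^ 2 =
      8 * (n * ρ ^ 2) * degreeMoment (D * δ ^ 4) A := by
    rw [mul_pow, mul_pow, Real.sq_sqrt
      (mul_nonneg (by positivity) (degreeMoment_nonneg _ A))]
    ring
  have hfour : ∀ a b c d : ℝ, (a + b + c + d) ^ 2 ≤ 4 * (a ^ 2 + b ^ 2 + c ^ 2 + d ^ 2) := by
    intro a b c d
    nlinarith [sq_nonneg (a - b), sq_nonneg (a - c), sq_nonneg (a - d), sq_nonneg (b - c),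
      sq_nonneg (b - d), sq_nonneg (c - d)]
  refine (hfour _ _ _ _).trans ?_
  rw [h3, mul_pow (δ ^ 2) (noiseConst D), ← pow_mul]
  linarith

end Deterministic

/-- The expected squared spectral norm of the truncated noise is of order `n ρ`. -/
theorem IsRandomAdjacency.integral_sq_noiseBound_le {Ω : Type*} [MeasurableSpace Ω]
    {μ : Measure Ω} [IsProbabilityMeasure μ] {n : ℕ} {M : Matrix (Fin n) (Fin n) ℝ}
    {A : Ω → Matrix (Fin n) (Fin n) ℝ} {δ ρ D : ℝ} (h : IsRandomAdjacency μ M A) (hn : 0 < n)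
    (hM : ∀ i j, M i j ∈ Set.Icc 0 ρ) (hsymm : ∀ i j, M i j = M j i) (hdiag : ∀ i, M i i = 0)
    (hδ : 1 ≤ δ) (hρ : 0 ≤ ρ) (hδρ : δ ^ 4 = n * ρ) (hD : 5 ≤ D) :
    ∫ ω, noiseBound D δ ρ M (A ω) ^ 2 ∂μ ≤ 4 * (noiseConst D ^ 2 + 1048585) * δ ^ 4 := by
  have hδ0 : 0 < δ := by linarith
  have hn' : (0 : ℝ) < n := by exact_mod_cast hn
  have i1 := h.integrable_comp fun B => δ ^ 4 * noiseConst D ^ 2 + δ ^ 4 * lightMoment δ M B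
  have i2 := h.integrable_comp fun B => 4096 * δ ^ 2 / n *
    ∑ p ∈ heavyScales n δ, 4 ^ p.1 * 4 ^ p.2 * discrepancyMoment δ ρ p.1 p.2 B
  have i3 := h.integrable_comp fun B => 8 * (n * ρ ^ 2) * degreeMoment (D * δ ^ 4) B
  refine (integral_mono (h.integrable_comp fun B => noiseBound D δ ρ M B ^ 2)
    (((i1.add i2).add i3).const_mul 4) fun ω => sq_noiseBound_le hn hδ).trans ?_
  rw [integral_const_mul, integral_add' (i1.add i2) i3, integral_add' i1 i2,
    integral_add (integrable_const _) (h.integrable_comp fun B => δ ^ 4 * lightMoment δ M B),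
    integral_const_mul, integral_const_mul, integral_const_mul,
    integral_finsetSum _ fun p _ => h.integrable_comp fun B =>
      4 ^ p.1 * 4 ^ p.2 * discrepancyMoment δ ρ p.1 p.2 B]
  simp only [integral_const_mul, integral_const, probReal_univ, one_smul]
  have h1 := h.integral_lightMoment_le hM hsymm hdiag hδ hδρ
  have h2 : ∑ p ∈ heavyScales n δ, (4 : ℝ) ^ p.1 * 4 ^ p.2 *
      ∫ ω, discrepancyMoment δ ρ p.1 p.2 (A ω) ∂μ ≤ 256 * (n * δ ^ 2) := by
    refine (Finset.sum_le_sum fun p hp => ?_).trans (sum_heavyScales_weight_le hδ)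
    exact mul_le_of_le_one_right (by positivity)
      (h.integral_discrepancyMoment_le hM hsymm hdiag hδ hρ hp)
  have h3 := h.integral_degreeMoment_le hM hsymm hdiag hδ hδρ hD
  have h4 : 4096 * δ ^ 2 / n * ∑ p ∈ heavyScales n δ, (4 : ℝ) ^ p.1 * 4 ^ p.2 *
      ∫ ω, discrepancyMoment δ ρ p.1 p.2 (A ω) ∂μ ≤ 1048576 * δ ^ 4 := by
    calc _ ≤ 4096 * δ ^ 2 / n * (256 * (n * δ ^ 2)) := by gcongr
      _ = _ := by field_simp; ring
  have h5 : 8 * (n * ρ ^ 2) * ∫ ω, degreeMoment (D * δ ^ 4) (A ω) ∂μ ≤ 8 * δ ^ 4 := by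
    calc _ ≤ 8 * (n * ρ ^ 2) * (n / δ ^ 4) := by gcongr
      _ = 8 * (n * ρ) ^ 2 / δ ^ 4 := by ring
      _ = 8 * δ ^ 4 := by rw [← hδρ]; field_simp
  -- `1048585 = 1 + 1048576 + 8`, from the light, discrepancy and degree moments.
  nlinarith [pow_pos hδ0 4]

/-! ### From the spectral norm to the loss -/

theorem rank_block_le {n k : ℕ} (z : Fin n → Fin k) (Q : Matrix (Fin k) (Fin k) ℝ) :
    (Q.submatrix z z).rank ≤ k := by
  have h1 : Q.submatrix z z = (Q.submatrix z id) * ((1 : Matrix (Fin k) (Fin k) ℝ).submatrix id z) := by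
    ext i j
    simp [Matrix.mul_apply, Matrix.one_apply]
  rw [h1]
  exact (Matrix.rank_mul_le_left _ _).trans
    ((Matrix.rank_le_card_width _).trans_eq (Fintype.card_fin k))

theorem graphonLoss_le {n : ℕ} (hn : 2 ≤ n) (X M : Matrix (Fin n) (Fin n) ℝ) :
    graphonLoss X M ≤ 4 / n ^ 2 * frobeniusSq (X - M) := by
  have h1 : ∑ p ∈ Finset.univ.filter (fun p : Fin n × Fin n => p.1 < p.2),
      (X p.1 p.2 - M p.1 p.2) ^ 2 ≤ frobeniusSq (X - M) := by
    rw [frobeniusSq, ← Fintype.sum_prod_type' fun i j => (X - M) i j ^ 2]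
    exact Finset.sum_le_sum_of_subset_of_nonneg (Finset.filter_subset _ _)
      fun _ _ _ => sq_nonneg _
  have hn' : (2 : ℝ) ≤ n := by exact_mod_cast hn
  have h2 : ((n.choose 2 : ℕ) : ℝ)⁻¹ ≤ 4 / n ^ 2 := by
    rw [Nat.cast_choose_two, inv_eq_one_div, div_le_div_iff₀ (by nlinarith) (by positivity)]
    nlinarith
  rw [graphonLoss]
  exact mul_le_mul h2 h1 (Finset.sum_nonneg fun _ _ => sq_nonneg _) (by positivity)

theorem frobeniusSq_sub_le {n : ℕ} (X Y Z : Matrix (Fin n) (Fin n) ℝ) :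
    frobeniusSq (X - Z) ≤ 2 * frobeniusSq (X - Y) + 2 * frobeniusSq (Y - Z) := by
  simp only [frobeniusSq, Finset.mul_sum, ← Finset.sum_add_distrib, Matrix.sub_apply]
  refine Finset.sum_le_sum fun i _ => Finset.sum_le_sum fun j _ => ?_
  nlinarith [sq_nonneg (X i j - Y i j - (Y i j - Z i j))]

theorem frobeniusSq_diagonal_le {n : ℕ} {v : Fin n → ℝ} {r : ℝ} (h : ∀ i, |v i| ≤ r) :
    frobeniusSq (Matrix.diagonal v) ≤ n * r ^ 2 := by
  calc frobeniusSq (Matrix.diagonal v) = ∑ i, v i ^ 2 := by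
        refine Finset.sum_congr rfl fun i _ => ?_
        rw [Finset.sum_eq_single i (fun j _ hj => by simp [Matrix.diagonal_apply_ne' _ hj])
          (by simp), Matrix.diagonal_apply_eq]
    _ ≤ ∑ _i : Fin n, r ^ 2 := Finset.sum_le_sum fun i _ => sq_le_sq.2 <|
        (h i).trans (le_abs_self r)
    _ = n * r ^ 2 := by simp

/-- The loss of a best rank-`k` approximation of a matrix close to a block matrix. -/
theorem graphonLoss_le_of_hasOpBound {n k : ℕ} {ρ κ : ℝ} (hn : 2 ≤ n) (hρ : 0 ≤ ρ)
    {M T X : Matrix (Fin n) (Fin n) ℝ} (hM : M ∈ sparseSBM n k ρ) (hX : IsBestRankApprox k T X)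
    (h : HasOpBound (T - M) κ) :
    graphonLoss X M ≤ 128 * k / n ^ 2 * (κ ^ 2 + n * ρ ^ 2) := by
  obtain ⟨-, hdiag, z, Q, -, hQ, hMQ⟩ := hM
  have hk : (1 : ℝ) ≤ k := by exact_mod_cast (z ⟨0, by omega⟩).pos
  have hn' : (1 : ℝ) ≤ n := by exact_mod_cast (by omega : 1 ≤ n)
  set Y := Q.submatrix z z
  have hv : ∀ i, |Q (z i) (z i)| ≤ ρ := fun i => by
    rw [abs_of_nonneg (hQ _ _).1]; exact (hQ _ _).2
  have hv' : ∀ i, |-Q (z i) (z i)| ≤ ρ := fun i => by rw [abs_neg]; exact hv i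
  have hYM : Y - M = Matrix.diagonal fun i => Q (z i) (z i) := by
    ext i j
    by_cases hij : i = j
    · subst hij; simp [Y, hdiag]
    · simp [Y, hij, (hMQ i j hij).1]
  have hMY : M - Y = Matrix.diagonal fun i => -Q (z i) (z i) := by
    rw [← neg_sub, hYM, Matrix.diagonal_neg]
  -- `M` itself need not have rank at most `k` because of its zero diagonal, so `Y` serves as the
  -- comparison matrix.
  have hTY : HasOpBound (T - Y) (κ + ρ) := by
    have h1 := h.add (hasOpBound_diagonal hv' hρ)
    rwa [← hMY, sub_add_sub_cancel] at h1
  have h1 : frobeniusSq (X - Y) ≤ _ := hX.frobeniusSq_sub_le (rank_block_le z Q) hTY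
  have h2 := frobeniusSq_sub_le X Y M
  have h3 : frobeniusSq (Y - M) ≤ n * ρ ^ 2 := by
    rw [hYM]; exact frobeniusSq_diagonal_le hv
  refine (graphonLoss_le hn X M).trans ?_
  have h4 : frobeniusSq (X - M) ≤ 32 * k * (κ ^ 2 + n * ρ ^ 2) := by
    have h5 : (κ + ρ) ^ 2 ≤ 2 * (κ ^ 2 + ρ ^ 2) := by nlinarith [sq_nonneg (κ - ρ)]
    have h6 : 8 * k * (κ + ρ) ^ 2 ≤ 8 * k * (2 * (κ ^ 2 + ρ ^ 2)) := by gcongr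
    have hn2 : (2 : ℝ) ≤ n := by exact_mod_cast hn
    have h7 : n * ρ ^ 2 ≤ k * (n * ρ ^ 2) := le_mul_of_one_le_left (by positivity) hk
    have h9 : 0 ≤ k * (n * ρ ^ 2) := by positivity
    have h8 : 2 * (k * ρ ^ 2) ≤ n * (k * ρ ^ 2) := by gcongr
    linarith
  calc _ ≤ 4 / (n : ℝ) ^ 2 * (32 * k * (κ ^ 2 + n * ρ ^ 2)) := by gcongr
    _ = _ := by ring

theorem mainTheorem10 :
    ∃ c₁ > (0 : ℝ), ∃ c₂ > (0 : ℝ), ∀ C₁ ≥ c₁, ∀ C₂ ≥ c₂, ∃ C₃ > (0 : ℝ),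
      ∀ (n k : ℕ) (ρ : ℝ), 0 < ρ → ρ < 1 → C₁ ≤ n * ρ →
      ∀ M ∈ sparseSBM n k ρ,
      ∀ (Ω : Type*) [MeasurableSpace Ω] (μ : Measure Ω) [IsProbabilityMeasure μ]
        (A : Ω → Matrix (Fin n) (Fin n) ℝ), IsRandomAdjacency μ M A →
      ∀ Mhat : Matrix (Fin n) (Fin n) ℝ → Matrix (Fin n) (Fin n) ℝ,
        (∀ ω, IsBestRankApprox k (degreeTruncation (C₂ * (n * ρ)) (A ω)) (Mhat (A ω))) →
        Integrable (fun ω => graphonLoss (Mhat (A ω)) M) μ ∧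
          ∫ ω, graphonLoss (Mhat (A ω)) M ∂μ ≤ C₃ * (ρ * k / n) := by
  -- `c₁ = 1` ensures `δ ≥ 1`, and `c₂ = 5` is the degree threshold. The added 1 in `C₃` absorbs the
  -- diagonal error, through `n ρ² ≤ n ρ`.
  refine ⟨1, one_pos, 5, by norm_num, fun C₁ hC₁ C₂ hC₂ =>
    ⟨128 * (4 * (noiseConst C₂ ^ 2 + 1048585) + 1), by positivity, ?_⟩⟩
  intro n k ρ hρ hρ1 hnρ M hM Ω _ μ _ A hA Mhat hMhat
  refine ⟨hA.integrable_comp fun B => graphonLoss (Mhat B) M, ?_⟩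
  have hd : 1 ≤ n * ρ := hC₁.trans hnρ
  -- From `n ρ ≥ 1` and `ρ < 1`; thus `n.choose 2` is nonzero.
  have hn1 : (1 : ℝ) < n := by
    by_contra! hc
    nlinarith
  have hn : 2 ≤ n := by exact_mod_cast hn1
  set δ := √√(n * ρ) with hδ'
  have hδ4 : δ ^ 4 = n * ρ := by
    rw [show 4 = 2 * 2 from rfl, pow_mul, hδ', Real.sq_sqrt (Real.sqrt_nonneg _),
      Real.sq_sqrt (by linarith)]
  have hδ : 1 ≤ δ := Real.one_le_sqrt.2 (Real.one_le_sqrt.2 hd)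
  have hsymm : ∀ i j, M i j = M j i := by
    obtain ⟨-, -, z, Q, -, -, hMQ⟩ := hM
    intro i j
    by_cases hij : i = j
    · rw [hij]
    · rw [(hMQ i j hij).1, (hMQ i j hij).2]
  have hpt : ∀ ω, graphonLoss (Mhat (A ω)) M ≤
      128 * k / n ^ 2 * (noiseBound C₂ δ ρ M (A ω) ^ 2 + n * ρ ^ 2) := by
    intro ω
    refine graphonLoss_le_of_hasOpBound hn hρ.le hM (hMhat ω) ?_
    rw [← hδ4]
    exact hasOpBound_noiseBound (by omega) hM.1 hρ.le hδ hδ4 (by linarith) (hA.zero_or_one ω)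
      (hA.symm ω)
  have hint := hA.integral_sq_noiseBound_le (by omega) hM.1 hsymm hM.2.1 hδ hρ.le hδ4 hC₂
  refine (integral_mono (hA.integrable_comp fun B => graphonLoss (Mhat B) M)
    (hA.integrable_comp fun B => 128 * k / n ^ 2 * (noiseBound C₂ δ ρ M B ^ 2 + n * ρ ^ 2))
    hpt).trans ?_
  rw [integral_const_mul, integral_add (hA.integrable_comp fun B => noiseBound C₂ δ ρ M B ^ 2)
    (integrable_const _), integral_const, probReal_univ, one_smul]
  rw [hδ4] at hint
  have hlast : n * ρ ^ 2 ≤ n * ρ := by nlinarith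
  calc _ ≤ 128 * k / (n : ℝ) ^ 2 * (4 * (noiseConst C₂ ^ 2 + 1048585) * (n * ρ) + n * ρ) := by
        gcongr
    _ = _ := by field_simp
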